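/- Let $d,m\ge 1$, $T>0$, and let $H:\mathbb{R}^d\to\mathbb{R}^d$ and $G^\ell:\mathbb{R}^d\to\mathbb{R}^d$, $\ell=1,\dots,d$, be locally Lipschitz with sub-linear growth, i.e. $|H(\xi)|\le C_H(1+|\xi|)$ and $|G^\ell(\xi)|\le C_G^\ell(1+|\xi|)$ for all $\xi$. Let $\mathcal{P}_1(\mathbb{R}^d)$ be the set of Borel probability measures on $\mathbb{R}^d$ with finite first moment, $\mathcal{W}_1$ the $1$-Wasserstein distance, and $\chi=\mathbb{R}^{dm}\times\mathcal{P}_1(\mathbb{R}^d)$ with the distance $\frac1m\sum_{k=1}^m|Y_k-Y_k'|+\mathcal{W}_1(\mu,\mu')$. For $Y,\mathbf{u}\in(\mathbb{R}^d)^m$ put $\mu_{m\ell}=\frac1m\sum_{k=1}^m u_{k\ell}\,\delta_{Y_k}$, where $u_{k\ell}$ is the $\ell$-th coordinate of $\mathbf{u}_k$, so that $G^\ell*\mu_{m\ell}(x)=\frac1m\sum_{k=1}^m u_{k\ell}\,G^\ell(x-Y_k)$. Let $(Y^0,\mu^0)\in\chi$ with $\mu^0$ supported in a closed ball $\bar B(0,R)$.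 For each $N$ let $\mu^0_N=\frac1N\sum_{i=1}^N\delta_{X^0_{N,i}}$ with $X^0_{N,i}\in \bar B(0,R)$, and assume $\mathcal{W}_1(\mu^0_N,\mu^0)\to0$. Let $\mathcal{U}\subset\mathbb{R}^{md}$ be nonempty and compact, and let $\mathbf{u}_N,\mathbf{u}^*\in L^\infty([0,T],\mathcal{U})$ with $\mathbf{u}_N\to\mathbf{u}^*$ in $L^\infty$. Then: 1. For each $N$, the system $$\dot Y_k=\mathbf{u}_{N,k}\ (k=1,\dots,m),\qquad \dot X_i=H*\mu_N(X_i)+\sum_{\ell=1}^d G^\ell*\mu_{m\ell}(X_i)\ (i=1,\dots,N),\qquad \mu_N=\frac1N\sum_{j=1}^N\delta_{X_j},$$ with $\mu_{m\ell}$ built from $Y$ and the control $\mathbf{u}_N$, and with initial datum $(Y^0,X^0_N)$, has exactly one Carath\'eodory solution on $[0,T]$ (absolutely continuous, satisfying the equations for a.e. $t$). Denote it by $(Y_N,X_N)$ and let $\mu_N(t)$ be the empirical measure of $X_N(t)$. 2. The sequence $(Y_N,\mu_N)$ converges in $C^0([0,T],\chi)$, i.e. uniformly on $[0,T]$ in the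 distance of $\chi$, to some $(Y^*,\mu^*)$ with $(Y^*(0),\mu^*(0))=(Y^0,\mu^0)$ which is a solution with control $\mathbf{u}^*$ of $$\dot Y_k=\mathbf{u}_k,\qquad \partial_t\mu+\nabla\cdot\Bigl[\bigl(H*\mu+\sum_{\ell=1}^dG^\ell*\mu_{m\ell}\bigr)\mu\Bigr]=0$$ in the following sense: there is $R'>0$ with $\mathrm{supp}\,\mu^*(t)\subset B(0,R')$ for all $t\in[0,T]$; $t\mapsto(Y^*(t),\mu^*(t))$ is continuous from $[0,T]$ to $\chi$; $Y^*$ is a Carath\'eodory solution of $\dot Y^*_k=\mathbf{u}^*_k$; and for every $\varphi\in C_c^\infty(\mathbb{R}^d)$ the function $t\mapsto\int\varphi\,d\mu^*(t)$ is absolutely continuous on $[0,T]$ with $$\frac{d}{dt}\int_{\mathbb{R}^d}\varphi\,d\mu^*(t)=\int_{\mathbb{R}^d}\nabla\varphi(x)\cdot\Bigl(H*\mu^*(t)(x)+\sum_{\ell=1}^dG^\ell*\mu_{m\ell}(t)(x)\Bigr)d\mu^*(t)(x)\quad\text{for a.e. }t\in[0,T],$$ where $\mu_{m\ell}(t)$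 is built from $Y^*(t)$ and $\mathbf{u}^*(t)$. -/

import Mathlib

open MeasureTheory Filter Topology
open scoped ENNReal ContDiff

noncomputable section

/-- The state space `ℝ^d` of one agent, with the Euclidean norm. -/
abbrev AgentSpace (d : ℕ) : Type := EuclideanSpace ℝ (Fin d)

/-- Membership in `𝒫₁(ℝ^d)`: probability measures with finite first moment. -/
structure MemP1 {d : ℕ} (μ : Measure (AgentSpace d)) : Prop where
  isProbability : IsProbabilityMeasure μ
  finite_moment : Integrable (fun x => ‖x‖) μ

/-- The `1`-Wasserstein distance: the infimum over all couplings `π` of `μ` and `ν` of the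
transport cost `∫ |x - y| dπ(x, y)`, as an extended nonnegative number. -/
def wassersteinOne {d : ℕ} (μ ν : Measure (AgentSpace d)) : ℝ≥0∞ :=
  ⨅ (π : Measure (AgentSpace d × AgentSpace d))
    (_ : π.map Prod.fst = μ ∧ π.map Prod.snd = ν), ∫⁻ p, edist p.1 p.2 ∂π

/-- The distance on `χ = ℝ^{dm} × 𝒫₁(ℝ^d)`:
`(1/m) ∑ k, |Y k - Y' k| + W₁(μ, μ')`. -/
def chiDist {d m : ℕ} (Y : Fin m → AgentSpace d) (μ : Measure (AgentSpace d))
    (Y' : Fin m → AgentSpace d) (μ' : Measure (AgentSpace d)) : ℝ≥0∞ :=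
  (m : ℝ≥0∞)⁻¹ * ∑ k, edist (Y k) (Y' k) + wassersteinOne μ μ'

/-- The empirical measure `(1/N) ∑ i, δ_{X i}`. -/
def empirical {d N : ℕ} (X : Fin N → AgentSpace d) : Measure (AgentSpace d) :=
  (N : ℝ≥0∞)⁻¹ • ∑ i, Measure.dirac (X i)

/-- The kernels: `H` and all `G ℓ` are locally Lipschitz with sub-linear growth. -/
structure KernelHypothesis {d : ℕ} (H : AgentSpace d → AgentSpace d)
    (G : Fin d → AgentSpace d → AgentSpace d) : Prop where
  lipschitz_H : LocallyLipschitz H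
  lipschitz_G : ∀ ℓ, LocallyLipschitz (G ℓ)
  growth_H : ∃ C : ℝ, ∀ ξ, ‖H ξ‖ ≤ C * (1 + ‖ξ‖)
  growth_G : ∀ ℓ, ∃ C : ℝ, ∀ ξ, ‖G ℓ ξ‖ ≤ C * (1 + ‖ξ‖)

/-- `u ∈ L^∞([0,T], 𝒰)`, for a compact set `𝒰` of control values. -/
structure IsControl {d m : ℕ} (T : ℝ) (𝒰 : Set (Fin m → AgentSpace d))
    (u : ℝ → Fin m → AgentSpace d) : Prop where
  measurable : AEStronglyMeasurable u (volume.restrict (Set.Icc 0 T))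
  mem : ∀ᵐ t ∂(volume.restrict (Set.Icc 0 T)), u t ∈ 𝒰

/-- The convolution `H * μ`. -/
def convH {d : ℕ} (H : AgentSpace d → AgentSpace d) (μ : Measure (AgentSpace d))
    (x : AgentSpace d) : AgentSpace d :=
  ∫ z, H (x - z) ∂μ

/-- The convolution of `g` with the finitely supported signed measure
`(1/m) ∑ k, v k ℓ • δ_{Y k}`, where `v k ℓ` is the `ℓ`-th coordinate of the `k`-th control. -/
def convG {d m : ℕ} (g : AgentSpace d → AgentSpace d) (Y v : Fin m → AgentSpace d) (ℓ : Fin d)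
    (x : AgentSpace d) : AgentSpace d :=
  (m : ℝ)⁻¹ • ∑ k, v k ℓ • g (x - Y k)

/-- The velocity field `H * μ + ∑ ℓ, G ℓ * μ_{mℓ}`. -/
def velocity {d m : ℕ} (H : AgentSpace d → AgentSpace d)
    (G : Fin d → AgentSpace d → AgentSpace d) (μ : Measure (AgentSpace d))
    (Y v : Fin m → AgentSpace d) (x : AgentSpace d) : AgentSpace d :=
  convH H μ x + ∑ ℓ, convG (G ℓ) Y v ℓ x

/-- `Y' = w` on `[0,T]` in the Caratheodory sense: `Y` is absolutely continuous on `[0,T]` and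
has derivative `w t` at almost every `t ∈ [0,T]`. -/
structure HasCaratheodoryDeriv {F : Type*} [NormedAddCommGroup F] [NormedSpace ℝ F] (T : ℝ)
    (y w : ℝ → F) : Prop where
  absolutelyContinuous : AbsolutelyContinuousOnInterval y 0 T
  ae_hasDerivAt : ∀ᵐ t ∂(volume.restrict (Set.Icc 0 T)), HasDerivAt y (w t) t

/-- Caratheodory solutions of the finite system with `m` leaders and `N` followers, control `u`
and initial datum `(Y0, X0)`. -/
structure IsFiniteSolution {d m N : ℕ} (H : AgentSpace d → AgentSpace d)
    (G : Fin d → AgentSpace d → AgentSpace d) (T : ℝ) (u : ℝ → Fin m → AgentSpace d)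
    (Y0 : Fin m → AgentSpace d) (X0 : Fin N → AgentSpace d)
    (Y : ℝ → Fin m → AgentSpace d) (X : ℝ → Fin N → AgentSpace d) : Prop where
  initial_leaders : Y 0 = Y0
  initial_followers : X 0 = X0
  leaders : ∀ k, HasCaratheodoryDeriv T (fun t => Y t k) (fun t => u t k)
  followers : ∀ i, HasCaratheodoryDeriv T (fun t => X t i)
    (fun t => velocity H G (empirical (X t)) (Y t) (u t) (X t i))

/-- Weak measure-valued solutions `(Y, μ) : [0,T] → χ` of
`Y' = u`, `∂ₜ μ + ∇ · ((H * μ + ∑ ℓ, G ℓ * μ_{mℓ}) μ) = 0`, with control `u`. Since `u` is only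
measurable in time, the weak equation is understood, as the leaders' one, in the Caratheodory
sense. -/
structure IsMeanFieldSolution {d m : ℕ} (H : AgentSpace d → AgentSpace d)
    (G : Fin d → AgentSpace d → AgentSpace d) (T : ℝ) (u : ℝ → Fin m → AgentSpace d)
    (Y : ℝ → Fin m → AgentSpace d) (μ : ℝ → Measure (AgentSpace d)) : Prop where
  memP1 : ∀ t ∈ Set.Icc 0 T, MemP1 (μ t)
  support : ∃ R : ℝ, 0 < R ∧ ∀ t ∈ Set.Icc 0 T, (μ t).support ⊆ Metric.ball 0 R
  continuous : ∀ t ∈ Set.Icc 0 T,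
    Tendsto (fun s => chiDist (Y s) (μ s) (Y t) (μ t)) (𝓝[Set.Icc 0 T] t) (𝓝 0)
  leaders : ∀ k, HasCaratheodoryDeriv T (fun t => Y t k) (fun t => u t k)
  weak : ∀ φ : AgentSpace d → ℝ, ContDiff ℝ ∞ φ → HasCompactSupport φ →
    HasCaratheodoryDeriv T (fun t => ∫ x, φ x ∂(μ t))
      (fun t => ∫ x, inner ℝ (gradient φ x) (velocity H G (μ t) (Y t) (u t) x) ∂(μ t))

end

/-! Particles and limit obey one and the same equation. Let `ν` be the initial measure and `Φ t` the
map sending an initial position to the position at time `t`. Then `Φ' = velocity[Φ_# ν] ∘ Φ` is an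
ODE in the Banach space of bounded continuous maps. For empirical `ν`, evaluating `Φ` at the initial
particles solves the finite system (`IsFlow.isFiniteSolution`); for `ν = μ0`, the images `Φ_# μ0`
solve the continuity equation (`IsFlow.isMeanFieldSolution`).

The kernels are only locally Lipschitz, so they are composed with a clamp; the ODE becomes globally
Lipschitz and Picard iteration solves it (`exists_isFlow`). Sub-linear growth bounds the flow
independently of the truncation radius (`IsFlow.norm_le`), so a radius chosen beyond that bound
leaves the dynamics unchanged. The identity is not a bounded map; the flow starts instead from a
clamp that is the identity on the ball containing the initial data.

Convergence is Dobrushin's argument. For every coupling `π` of two initial measures, Grönwall bounds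
`∫ |Φ t x - Φ' t y| dπ(x, y)` by a constant times the initial cost plus the distance of the controls
(`IsFlow.integral_norm_sub_le`). The infimum over `π` gives stability in `W₁`
(`IsFlow.wassersteinOne_le`), and both error terms tend to zero. Uniqueness
(`IsFiniteSolution.eqOn`) transfers the estimate to arbitrary solutions of the finite systems. -/

noncomputable section

open Set NNReal BoundedContinuousFunction

/-! ### Grönwall's inequality and integrability of bounded functions -/

/-- Integral form of Grönwall's inequality. -/
theorem le_mul_exp_of_le_add_integral {T a b : ℝ} {f : ℝ → ℝ} (hb : 0 ≤ b)
    (hf : ContinuousOn f (Icc 0 T))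
    (h : ∀ t ∈ Icc 0 T, f t ≤ a + ∫ s in (0 : ℝ)..t, b * f s) :
    ∀ t ∈ Icc 0 T, f t ≤ a * Real.exp (b * t) := by
  intro t ht
  have hT : 0 ≤ T := ht.1.trans ht.2
  -- The constant extension of `f` outside `[0,T]` is continuous, so its primitive `g` is
  -- differentiable everywhere. From `f₁ ≤ g` follows `g' ≤ b * g`, and the differential form of
  -- Grönwall applies to `g`.
  set f₁ : ℝ → ℝ := fun s => f (projIcc 0 T hT s) with hf₁
  have hf₁c : Continuous f₁ :=
    (continuousOn_iff_continuous_domRestrict.1 hf).comp continuous_projIcc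
  have hf₁e : ∀ s ∈ Icc 0 T, f₁ s = f s := fun s hs => by
    simp [hf₁, projIcc_of_mem hT hs]
  set g : ℝ → ℝ := fun t => a + ∫ s in (0 : ℝ)..t, b * f₁ s with hg
  have hgd : ∀ s, HasDerivAt g (b * f₁ s) s := fun s =>
    ((hf₁c.const_mul b).integral_hasStrictDerivAt 0 s).hasDerivAt.const_add a
  have hfg : ∀ s ∈ Icc 0 T, f₁ s ≤ g s := by
    intro s hs
    rw [hf₁e s hs]
    refine (h s hs).trans_eq ?_
    simp only [hg, add_right_inj]
    refine intervalIntegral.integral_congr fun r hr => ?_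
    rw [uIcc_of_le hs.1] at hr
    simp only [hf₁e r ⟨hr.1, hr.2.trans hs.2⟩]
  have := le_gronwallBound_of_liminf_deriv_right_le (f := g) (f' := fun s => b * f₁ s)
    (δ := a) (K := b) (ε := 0) (a := 0) (b := T)
    (fun s _ => (hgd s).continuousAt.continuousWithinAt)
    (fun s _ r hr => (hgd s).hasDerivWithinAt.liminf_right_slope_le hr) (by simp [hg])
    (fun s hs => by
      rw [add_zero]
      exact mul_le_mul_of_nonneg_left (hfg s ⟨hs.1, hs.2.le⟩) hb) t ht
  rw [gronwallBound_ε0, sub_zero] at this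
  exact (hf₁e t ht ▸ hfg t ht).trans this

theorem intervalIntegrable_of_bound {E : Type*} [NormedAddCommGroup E] {T : ℝ} {B : ℝ≥0}
    {g : ℝ → E}
    (hg : AEStronglyMeasurable g (volume.restrict (Icc 0 T)))
    (hB : ∀ᵐ s ∂(volume.restrict (Icc 0 T)), ‖g s‖ ≤ B) {s t : ℝ} (hs : s ∈ Icc 0 T)
    (ht : t ∈ Icc 0 T) : IntervalIntegrable g volume s t := by
  have h : IntegrableOn g (Icc 0 T) volume :=
    Integrable.of_bound hg B hB
  refine (h.mono_set ?_).intervalIntegrable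
  exact (convex_Icc (0 : ℝ) T).ordConnected.uIcc_subset hs ht

/-! ### Carathéodory derivatives and primitives of bounded functions -/

section Primitive

variable {E : Type*} [NormedAddCommGroup E] [NormedSpace ℝ E] {T : ℝ} {B : ℝ≥0} {x g : ℝ → E}

theorem lipschitzOnWith_of_eq_integral
    (hg : AEStronglyMeasurable g (volume.restrict (Icc 0 T)))
    (hB : ∀ᵐ s ∂(volume.restrict (Icc 0 T)), ‖g s‖ ≤ B) (x₀ : E)
    (hx : ∀ t ∈ Icc 0 T, x t = x₀ + ∫ s in (0 : ℝ)..t, g s) :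
    LipschitzOnWith B x (Icc 0 T) := by
  refine LipschitzOnWith.of_dist_le_mul fun s hs t ht => ?_
  have h0 : (0 : ℝ) ∈ Icc 0 T := ⟨le_rfl, hs.1.trans hs.2⟩
  rw [hx s hs, hx t ht, dist_add_left, dist_eq_norm, Real.dist_eq,
    intervalIntegral.integral_interval_sub_left (intervalIntegrable_of_bound hg hB h0 hs)
      (intervalIntegrable_of_bound hg hB h0 ht)]
  refine intervalIntegral.norm_integral_le_of_norm_le_const_ae ?_
  rw [ae_restrict_iff' measurableSet_Icc] at hB
  filter_upwards [hB] with r hr hrm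
  exact hr ((convex_Icc (0 : ℝ) T).ordConnected.uIcc_subset ht hs (uIoc_subset_uIcc hrm))

theorem hasCaratheodoryDeriv_of_eq_integral [CompleteSpace E]
    (hg : AEStronglyMeasurable g (volume.restrict (Icc 0 T)))
    (hB : ∀ᵐ s ∂(volume.restrict (Icc 0 T)), ‖g s‖ ≤ B) (x₀ : E) (hT : 0 ≤ T)
    (hx : ∀ t ∈ Icc 0 T, x t = x₀ + ∫ s in (0 : ℝ)..t, g s) :
    HasCaratheodoryDeriv T x g := by
  refine ⟨LipschitzOnWith.absolutelyContinuousOnInterval (K := B) ?_, ?_⟩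
  · rw [uIcc_of_le hT]
    exact lipschitzOnWith_of_eq_integral hg hB x₀ hx
  · have h0 : (0 : ℝ) ∈ Icc 0 T := ⟨le_rfl, hT⟩
    have hint := intervalIntegrable_of_bound hg hB h0 ⟨hT, le_rfl⟩
    rw [ae_restrict_iff' measurableSet_Icc]
    -- The endpoints are discarded because `x` agrees with the primitive on `[0,T]` only, while
    -- `HasDerivAt` is two-sided.
    have h₁ : ∀ᵐ t : ℝ, t ≠ 0 := by simp [ae_iff]
    have h₂ : ∀ᵐ t : ℝ, t ≠ T := by simp [ae_iff]
    filter_upwards [hint.ae_hasDerivAt_integral, h₁, h₂] with t ht h₁ h₂ htI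
    rw [uIcc_of_le hT] at ht
    refine ((ht htI 0 h0).const_add x₀).congr_of_eventuallyEq ?_
    filter_upwards [Icc_mem_nhds (lt_of_le_of_ne htI.1 h₁.symm) (lt_of_le_of_ne htI.2 h₂)]
      with s hs using hx s hs

/-- The difference of `x` and the primitive of `g` is absolutely continuous with zero derivative
almost everywhere, hence constant. -/
theorem HasCaratheodoryDeriv.eq_integral [CompleteSpace E] (hx : HasCaratheodoryDeriv T x g)
    (hT : 0 ≤ T) (hg : AEStronglyMeasurable g (volume.restrict (Icc 0 T)))
    (hB : ∀ᵐ s ∂(volume.restrict (Icc 0 T)), ‖g s‖ ≤ B) :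
    ∀ t ∈ Icc 0 T, x t = x 0 + ∫ s in (0 : ℝ)..t, g s := by
  have hp := hasCaratheodoryDeriv_of_eq_integral (x := fun t => 0 + ∫ s in (0 : ℝ)..t, g s) hg hB 0
    hT (fun _ _ => rfl)
  obtain ⟨c, hc⟩ := (hx.absolutelyContinuous.sub hp.absolutelyContinuous).const_of_ae_hasDerivAt_zero
    (by
      rw [uIcc_of_le hT]
      have h₁ := (ae_restrict_iff' measurableSet_Icc).1 hx.ae_hasDerivAt
      have h₂ := (ae_restrict_iff' measurableSet_Icc).1 hp.ae_hasDerivAt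
      filter_upwards [h₁, h₂] with t h₁ h₂ ht
      simpa using (h₁ ht).sub (h₂ ht))
  rw [uIcc_of_le hT] at hc
  intro t ht
  have e₁ := hc t ht
  have e₂ := hc 0 ⟨le_rfl, hT⟩
  simp only [Pi.sub_apply, zero_add, intervalIntegral.integral_same, sub_zero] at e₁ e₂
  rw [e₂, ← e₁]
  abel

/-- Almost everywhere `g` is `deriv x`, which is measurable for every `x`. Thus the right-hand side
along an arbitrary solution is measurable for free. -/
theorem HasCaratheodoryDeriv.aestronglyMeasurable [CompleteSpace E] [SecondCountableTopology E]
    (hx : HasCaratheodoryDeriv T x g) :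
    AEStronglyMeasurable g (volume.restrict (Icc 0 T)) := by
  borelize E
  refine (stronglyMeasurable_deriv x).aestronglyMeasurable.congr ?_
  filter_upwards [hx.ae_hasDerivAt] with t ht using ht.deriv

end Primitive

/-! ### Picard iteration -/

section Picard

variable {E : Type*} [NormedAddCommGroup E] [NormedSpace ℝ E] [CompleteSpace E]
  {T M : ℝ} {L : ℝ≥0} {F : ℝ → E → E}

/-- Existence of Carathéodory solutions for a vector field that is globally Lipschitz in space and
measurable along continuous curves. -/
theorem exists_eq_integral_of_lipschitz (hT : 0 ≤ T)
    (hL : ∀ s ∈ Icc 0 T, LipschitzWith L (F s)) (hM : ∀ s ∈ Icc 0 T, ‖F s 0‖ ≤ M)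
    (hmeas : ∀ x : ℝ → E, Continuous x →
      AEStronglyMeasurable (fun s => F s (x s)) (volume.restrict (Icc 0 T))) (x₀ : E) :
    ∃ x : ℝ → E, Continuous x ∧
      ∀ t ∈ Icc 0 T, x t = x₀ + ∫ s in (0 : ℝ)..t, F s (x s) := by
  let p : ℝ → Icc (0 : ℝ) T := projIcc 0 T hT
  have hp : Continuous p := continuous_projIcc
  have hpe : ∀ t (ht : t ∈ Icc 0 T), p t = ⟨t, ht⟩ := fun t ht => projIcc_of_mem hT ht
  have hmeasα (α : C(Icc (0 : ℝ) T, E)) : AEStronglyMeasurable (fun s => F s (α (p s)))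
      (volume.restrict (Icc 0 T)) := hmeas _ (α.continuous.comp hp)
  have hM0 : 0 ≤ M := (norm_nonneg _).trans (hM 0 ⟨le_rfl, hT⟩)
  have hbdα (α : C(Icc (0 : ℝ) T, E)) : ∀ᵐ s ∂(volume.restrict (Icc 0 T)),
      ‖F s (α (p s))‖ ≤ (⟨M + L * ‖α‖, by positivity⟩ : ℝ≥0) := by
    filter_upwards [ae_restrict_mem measurableSet_Icc] with s hs
    have h1 := (hL s hs).dist_le_mul (α (p s)) 0
    rw [dist_eq_norm, dist_zero_right] at h1
    have h2 : (L : ℝ) * ‖α (p s)‖ ≤ L * ‖α‖ := by gcongr; exact α.norm_coe_le_norm _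
    have h3 := norm_le_norm_add_norm_sub (F s 0) (F s (α (p s)))
    rw [norm_sub_rev] at h3
    change _ ≤ M + L * ‖α‖
    linarith [hM s hs]
  have h0 : (0 : ℝ) ∈ Icc 0 T := ⟨le_rfl, hT⟩
  have hint (α : C(Icc (0 : ℝ) T, E)) {t : ℝ} (ht : t ∈ Icc 0 T) :
      IntervalIntegrable (fun s => F s (α (p s))) volume 0 t :=
    intervalIntegrable_of_bound (hmeasα α) (hbdα α) h0 ht
  let Q : C(Icc (0 : ℝ) T, E) → C(Icc (0 : ℝ) T, E) := fun α =>
    ⟨fun t => x₀ + ∫ s in (0 : ℝ)..t, F s (α (p s)), continuousOn_iff_continuous_domRestrict.1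
      (lipschitzOnWith_of_eq_integral (x := fun t => x₀ + ∫ s in (0 : ℝ)..t, F s (α (p s)))
        (hmeasα α) (hbdα α) x₀ (fun _ _ => rfl)).continuousOn⟩
  have hQ (α t) : Q α t = x₀ + ∫ s in (0 : ℝ)..t, F s (α (p s)) := rfl
  -- The factor `(L * t) ^ n / n!` tends to zero, so some iterate of `Q` is a contraction, whatever
  -- the size of `T`.
  have hiter : ∀ (n : ℕ) (α β : C(Icc (0 : ℝ) T, E)) (t : Icc (0 : ℝ) T),
      dist (Q^[n] α t) (Q^[n] β t) ≤ (L * t) ^ n / n.factorial * dist α β := by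
    intro n α β
    induction n with
    | zero => intro t; simpa using ContinuousMap.dist_apply_le_dist t
    | succ n ih =>
      intro t
      rw [Function.iterate_succ_apply', Function.iterate_succ_apply', hQ, hQ, dist_add_left,
        dist_eq_norm, ← intervalIntegral.integral_sub (hint _ t.2) (hint _ t.2)]
      refine (intervalIntegral.norm_integral_le_of_norm_le t.2.1
        (g := fun s => L * ((L * s) ^ n / n.factorial * dist α β)) ?_
        (Continuous.intervalIntegrable (by fun_prop) _ _)).trans_eq ?_
      · refine Eventually.of_forall fun s hs => ?_
        have hs' : s ∈ Icc 0 T := ⟨hs.1.le, hs.2.trans t.2.2⟩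
        rw [← dist_eq_norm]
        refine ((hL s hs').dist_le_mul _ _).trans ?_
        gcongr
        have := ih (p s)
        rwa [show ((p s : Icc (0 : ℝ) T) : ℝ) = s by rw [hpe s hs']] at this
      · have : (fun s : ℝ => (L : ℝ) * ((L * s) ^ n / n.factorial * dist α β)) =
            fun s => (L ^ (n + 1) / n.factorial * dist α β) * s ^ n := by
          funext s; rw [mul_pow]; ring
        rw [this, intervalIntegral.integral_const_mul, integral_pow, Nat.factorial_succ]
        have : (n.factorial : ℝ) ≠ 0 := by positivity
        have : (n + 1 : ℝ) ≠ 0 := by positivity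
        push_cast
        field_simp
        rw [zero_pow n.succ_ne_zero, sub_zero, mul_pow]
        ring
  obtain ⟨n, hn⟩ := (FloorSemiring.tendsto_pow_div_factorial_atTop (L * T)
    |>.eventually (gt_mem_nhds zero_lt_one)).exists
  have hc : ContractingWith ⟨(L * T) ^ n / n.factorial, by positivity⟩ Q^[n] := by
    refine ⟨hn, LipschitzWith.of_dist_le_mul fun α β => ?_⟩
    refine (ContinuousMap.dist_le (mul_nonneg (NNReal.coe_nonneg _) dist_nonneg)).2 fun t => (hiter n α β t).trans ?_
    change _ ≤ (L * T) ^ n / n.factorial * dist α β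
    have := t.2.1
    have := t.2.2
    gcongr
  -- The unique fixed point of a contracting iterate of `Q` is fixed by `Q` itself.
  obtain ⟨α, hα⟩ : ∃ α, Q α = α := ⟨_, hc.isFixedPt_fixedPoint_iterate⟩
  refine ⟨fun t => α (p t), α.continuous.comp hp, fun t ht => ?_⟩
  change α (p t) = _
  conv_lhs => rw [← hα, hQ, hpe t ht]

end Picard

/-! ### Truncation of locally Lipschitz kernels -/

section Clamp

variable {d : ℕ}

/-- The projection of `ℝ^d` onto the cube `[-r, r]^d`. -/
def clampBox (r : ℝ) (x : AgentSpace d) : AgentSpace d :=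
  WithLp.toLp 2 fun i => max (-r) (min r (x i))

/-- Clamping onto a cube acts on each coordinate separately, and each scalar clamp is nonexpansive.
-/
theorem clampBox_lipschitz (r : ℝ) : LipschitzWith 1 (clampBox r : AgentSpace d → AgentSpace d) := by
  refine LipschitzWith.of_dist_le_mul fun x y => ?_
  rw [NNReal.coe_one, one_mul, EuclideanSpace.dist_eq, EuclideanSpace.dist_eq]
  refine Real.sqrt_le_sqrt (Finset.sum_le_sum fun i _ => ?_)
  refine pow_le_pow_left₀ dist_nonneg ?_ 2
  simp only [clampBox, Real.dist_eq]
  refine (abs_max_sub_max_le_max _ _ _ _).trans ?_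
  simp only [sub_self, abs_zero]
  refine max_le (abs_nonneg _) ((abs_min_sub_min_le_max _ _ _ _).trans ?_)
  simp

theorem clampBox_of_norm_le {r : ℝ} {x : AgentSpace d} (h : ‖x‖ ≤ r) : clampBox r x = x := by
  ext i
  have h1 : |x i| ≤ r := (PiLp.norm_apply_le x i).trans h
  rw [abs_le] at h1
  simp [clampBox, h1.1, h1.2]

/-- Consequently a truncated kernel keeps its growth constant, uniformly in `r`. -/
theorem norm_clampBox_le {r : ℝ} (hr : 0 ≤ r) (x : AgentSpace d) : ‖clampBox r x‖ ≤ ‖x‖ := by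
  have h := (clampBox_lipschitz r).dist_le_mul x 0
  rw [clampBox_of_norm_le (x := 0) (by simpa using hr)] at h
  simpa using h

theorem norm_clampBox_le_const {r : ℝ} (hr : 0 ≤ r) (x : AgentSpace d) :
    ‖clampBox r x‖ ≤ √(d * r ^ 2) := by
  rw [EuclideanSpace.norm_eq]
  refine Real.sqrt_le_sqrt ?_
  refine (Finset.sum_le_card_nsmul _ _ (r ^ 2) fun i _ => ?_).trans_eq (by simp)
  refine pow_le_pow_left₀ (norm_nonneg _) ?_ 2
  rw [Real.norm_eq_abs, abs_le]
  constructor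
  · exact le_max_left _ _
  · exact max_le (by linarith) (min_le_left _ _)

/-- The clamp takes values in a compact ball, of radius half the diagonal of the cube, on which a
locally Lipschitz map is Lipschitz. -/
theorem LocallyLipschitz.exists_lipschitzWith_comp_clampBox {K : AgentSpace d → AgentSpace d}
    (hK : LocallyLipschitz K) {r : ℝ} (hr : 0 ≤ r) :
    ∃ L : ℝ≥0, LipschitzWith L (fun x => K (clampBox r x)) := by
  obtain ⟨L, hL⟩ := LocallyLipschitzOn.exists_lipschitzOnWith_of_compact
    (isCompact_closedBall (0 : AgentSpace d) √(d * r ^ 2)) (hK.locallyLipschitzOn (s := _))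
  refine ⟨L, LipschitzWith.of_dist_le_mul fun x y => ?_⟩
  have hm (z : AgentSpace d) : clampBox r z ∈ Metric.closedBall (0 : AgentSpace d) √(d * r ^ 2) := by
    simpa using norm_clampBox_le_const hr z
  refine (hL.dist_le_mul _ (hm x) _ (hm y)).trans ?_
  gcongr
  simpa using (clampBox_lipschitz r).dist_le_mul x y

end Clamp

/-! ### Estimates for the velocity field -/

section Velocity

variable {d m : ℕ} {H : AgentSpace d → AgentSpace d} {G : Fin d → AgentSpace d → AgentSpace d}

theorem norm_inv_smul_sum_le {F : Type*} [NormedAddCommGroup F] [NormedSpace ℝ F] {w : Fin m → F}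
    {c : ℝ} (hc : 0 ≤ c) (h : ∀ k, ‖w k‖ ≤ c) : ‖(m : ℝ)⁻¹ • ∑ k, w k‖ ≤ c := by
  rw [norm_smul, norm_inv, Real.norm_natCast]
  have h1 : ‖∑ k, w k‖ ≤ m * c := (norm_sum_le_of_le _ fun k _ => h k).trans_eq (by simp)
  rcases Nat.eq_zero_or_pos m with rfl | hm
  · simpa using hc
  · have : (0 : ℝ) < m := by exact_mod_cast hm
    rw [inv_mul_le_iff₀ this]
    exact h1

theorem norm_control_le {v : Fin m → AgentSpace d} {U : ℝ} (h : ‖v‖ ≤ U) (k : Fin m) (ℓ : Fin d) :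
    ‖v k ℓ‖ ≤ U :=
  ((PiLp.norm_apply_le (v k) ℓ).trans (norm_le_pi_norm v k)).trans h

variable {Ω : Type*} [MeasurableSpace Ω] {P : Measure Ω}

theorem convH_map (hH : Continuous H) {a : Ω → AgentSpace d} (ha : AEMeasurable a P)
    (x : AgentSpace d) : convH H (P.map a) x = ∫ w, H (x - a w) ∂P := by
  rw [convH, integral_map ha]
  exact (hH.comp (continuous_const.sub continuous_id)).aestronglyMeasurable

theorem integrable_kernel_comp [IsFiniteMeasure P] {L : ℝ≥0} (hH : LipschitzWith L H)
    {a : Ω → AgentSpace d} (ha : AEMeasurable a P) {A : ℝ} (haA : ∀ᵐ w ∂P, ‖a w‖ ≤ A)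
    (x : AgentSpace d) : Integrable (fun w => H (x - a w)) P := by
  refine Integrable.of_bound (C := ‖H 0‖ + L * (‖x‖ + A)) ?_ ?_
  · exact (hH.continuous.measurable.comp_aemeasurable (ha.const_sub x)).aestronglyMeasurable
  · filter_upwards [haA] with w hw
    have h1 := hH.dist_le_mul (x - a w) 0
    rw [dist_eq_norm, dist_zero_right] at h1
    have h2 : L * ‖x - a w‖ ≤ L * (‖x‖ + A) := by
      gcongr
      exact (norm_sub_le _ _).trans (by linarith)
    have h3 := norm_le_norm_add_norm_sub (H 0) (H (x - a w))
    rw [norm_sub_rev] at h3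
    linarith

/-- Each summand splits as `(v - v') g + v' (g - g')`. The control error multiplies the size of `g`,
not an increment of it; the hypothesis on `B` bounds this product, so that equal controls allow `δ =
B = 0` without any bound on `g`. -/
theorem norm_convG_sub_le {g : AgentSpace d → AgentSpace d} {L : ℝ≥0} (hg : LipschitzWith L g)
    {Y Y' v v' : Fin m → AgentSpace d} {x x' : AgentSpace d} {U η δ B : ℝ} (hU : ‖v'‖ ≤ U)
    (hη : ‖Y - Y'‖ ≤ η) (hδ : ‖v - v'‖ ≤ δ) (hB0 : 0 ≤ B) (hB : ∀ k, δ * ‖g (x - Y k)‖ ≤ B)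
    (ℓ : Fin d) :
    ‖convG g Y v ℓ x - convG g Y' v' ℓ x'‖ ≤ B + U * (L * (‖x - x'‖ + η)) := by
  have hU0 := (norm_nonneg _).trans hU
  have hη0 := (norm_nonneg _).trans hη
  have hδ0 := (norm_nonneg _).trans hδ
  rw [convG, convG, ← smul_sub, ← Finset.sum_sub_distrib]
  refine norm_inv_smul_sum_le (by positivity) fun k => ?_
  have : v k ℓ • g (x - Y k) - v' k ℓ • g (x' - Y' k) =
      (v - v') k ℓ • g (x - Y k) + v' k ℓ • (g (x - Y k) - g (x' - Y' k)) := by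
    simp only [Pi.sub_apply, PiLp.sub_apply, sub_smul, smul_sub]
    abel
  rw [this]
  refine (norm_add_le _ _).trans ?_
  rw [norm_smul, norm_smul]
  have h1 := norm_control_le hδ k ℓ
  have h2 := norm_control_le hU k ℓ
  have h3 : ‖g (x - Y k) - g (x' - Y' k)‖ ≤ L * (‖x - x'‖ + η) := by
    rw [← dist_eq_norm]
    refine (hg.dist_le_mul _ _).trans ?_
    gcongr
    rw [dist_eq_norm, show x - Y k - (x' - Y' k) = (x - x') - (Y - Y') k by
      simp only [Pi.sub_apply]; abel]
    refine (norm_sub_le _ _).trans ?_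
    gcongr
    exact (norm_le_pi_norm _ k).trans hη
  refine add_le_add ((mul_le_mul_of_nonneg_right h1 (norm_nonneg _)).trans (hB k)) ?_
  gcongr

/-- Two measures are compared as images of a common `P`, so that only `‖a - b‖` enters. In the
applications `P` is the initial measure, a coupling, or the uniform measure on particle labels. -/
theorem norm_velocity_sub_le [IsFiniteMeasure P] (hP : P.real univ ≤ 1) {L : ℝ≥0}
    (hH : LipschitzWith L H) (hG : ∀ ℓ, LipschitzWith L (G ℓ)) {a b : Ω → AgentSpace d}
    (ha : AEMeasurable a P) (hb : AEMeasurable b P) {A : ℝ} (haA : ∀ᵐ w ∂P, ‖a w‖ ≤ A)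
    (hbA : ∀ᵐ w ∂P, ‖b w‖ ≤ A) {Y Y' v v' : Fin m → AgentSpace d} {x x' : AgentSpace d}
    {U η δ B : ℝ} (hU : ‖v'‖ ≤ U) (hη : ‖Y - Y'‖ ≤ η) (hδ : ‖v - v'‖ ≤ δ) (hB0 : 0 ≤ B)
    (hB : ∀ ℓ k, δ * ‖G ℓ (x - Y k)‖ ≤ B) :
    ‖velocity H G (P.map a) Y v x - velocity H G (P.map b) Y' v' x'‖ ≤
      L * (‖x - x'‖ + ∫ w, ‖a w - b w‖ ∂P) + d * (B + U * (L * (‖x - x'‖ + η))) := by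
  rw [velocity, velocity, add_sub_add_comm, ← Finset.sum_sub_distrib]
  have hI : Integrable (fun w => ‖a w - b w‖) P := by
    refine Integrable.of_bound (C := A + A) (ha.sub hb).norm.aestronglyMeasurable ?_
    filter_upwards [haA, hbA] with w h1 h2
    rw [norm_norm]
    exact (norm_sub_le _ _).trans (add_le_add h1 h2)
  refine (norm_add_le _ _).trans (add_le_add ?_ ?_)
  · rw [convH_map hH.continuous ha, convH_map hH.continuous hb,
      ← integral_sub (integrable_kernel_comp hH ha haA x) (integrable_kernel_comp hH hb hbA x')]
    calc ‖∫ w, H (x - a w) - H (x' - b w) ∂P‖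
        ≤ ∫ w, L * (‖x - x'‖ + ‖a w - b w‖) ∂P := by
          refine norm_integral_le_of_norm_le
            (((integrable_const _).add hI).const_mul _) (Eventually.of_forall fun w => ?_)
          rw [← dist_eq_norm]
          refine (hH.dist_le_mul _ _).trans ?_
          gcongr
          rw [dist_eq_norm, show x - a w - (x' - b w) = (x - x') - (a w - b w) by abel]
          exact norm_sub_le _ _
      _ = L * (P.real univ * ‖x - x'‖ + ∫ w, ‖a w - b w‖ ∂P) := by
          rw [integral_const_mul, integral_add (integrable_const _) hI, integral_const, smul_eq_mul]
      _ ≤ _ := by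
          gcongr
          exact mul_le_of_le_one_left (norm_nonneg _) hP
  · refine (norm_sum_le_of_le _ fun ℓ _ =>
      norm_convG_sub_le (hG ℓ) hU hη hδ hB0 (hB ℓ) ℓ).trans_eq ?_
    rw [Finset.sum_const, Finset.card_univ, Fintype.card_fin, nsmul_eq_mul]

theorem norm_velocity_le [IsFiniteMeasure P] (hP : P.real univ ≤ 1) (hH : Continuous H)
    {C : ℝ} (hC : 0 ≤ C) (hCH : ∀ ξ, ‖H ξ‖ ≤ C * (1 + ‖ξ‖))
    (hCG : ∀ ℓ ξ, ‖G ℓ ξ‖ ≤ C * (1 + ‖ξ‖)) {a : Ω → AgentSpace d} (ha : AEMeasurable a P) {A : ℝ}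
    (hA : 0 ≤ A) (haA : ∀ᵐ w ∂P, ‖a w‖ ≤ A) {Y v : Fin m → AgentSpace d} {x : AgentSpace d}
    {U η : ℝ} (hU : ‖v‖ ≤ U) (hη : ‖Y‖ ≤ η) :
    ‖velocity H G (P.map a) Y v x‖ ≤
      C * (1 + ‖x‖ + A) + d * (U * (C * (1 + ‖x‖ + η))) := by
  have hU0 := (norm_nonneg _).trans hU
  have hη0 := (norm_nonneg _).trans hη
  rw [velocity]
  refine (norm_add_le _ _).trans (add_le_add ?_ ?_)
  · rw [convH_map hH ha]
    refine (norm_integral_le_of_norm_le_const (C := C * (1 + ‖x‖ + A)) ?_).trans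
      (mul_le_of_le_one_right (by positivity) hP)
    filter_upwards [haA] with w hw
    refine (hCH _).trans ?_
    rw [add_assoc]
    gcongr
    exact (norm_sub_le _ _).trans (by gcongr)
  · refine (norm_sum_le_of_le (n := fun _ => U * (C * (1 + ‖x‖ + η))) _ fun ℓ _ => ?_).trans_eq
      (by simp)
    refine norm_inv_smul_sum_le (by positivity) fun k => ?_
    rw [norm_smul]
    gcongr
    · exact norm_control_le hU k ℓ
    · refine (hCG _ _).trans ?_
      rw [add_assoc]
      gcongr
      exact (norm_sub_le _ _).trans (by gcongr; exact (norm_le_pi_norm _ k).trans hη)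

/-- The kernels are evaluated only at differences `x - z` and `x - Y k`, of norm at most `ρ + ρ` and
`ρ + η`; a truncation beyond these radii is invisible. -/
theorem velocity_congr {H' : AgentSpace d → AgentSpace d}
    {G' : Fin d → AgentSpace d → AgentSpace d} {r ρ η : ℝ}
    (hH : ∀ ξ, ‖ξ‖ ≤ r → H ξ = H' ξ) (hG : ∀ ℓ ξ, ‖ξ‖ ≤ r → G ℓ ξ = G' ℓ ξ)
    (h₁ : ρ + ρ ≤ r) (h₂ : ρ + η ≤ r) {μ : Measure (AgentSpace d)} (hμ : ∀ᵐ z ∂μ, ‖z‖ ≤ ρ)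
    {Y : Fin m → AgentSpace d} (hY : ‖Y‖ ≤ η) (v : Fin m → AgentSpace d) {x : AgentSpace d}
    (hx : ‖x‖ ≤ ρ) : velocity H G μ Y v x = velocity H' G' μ Y v x := by
  rw [velocity, velocity, convH, convH]
  congr 1
  · refine integral_congr_ae ?_
    filter_upwards [hμ] with z hz
    exact hH _ ((norm_sub_le _ _).trans (by linarith))
  · refine Finset.sum_congr rfl fun ℓ _ => ?_
    simp only [convG]
    congr 1
    refine Finset.sum_congr rfl fun k _ => ?_
    rw [hG ℓ _ ((norm_sub_le _ _).trans (by linarith [(norm_le_pi_norm Y k).trans hY]))]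

end Velocity

/-! ### The ODE for flow maps in the space of bounded continuous functions -/

section FlowField

variable {d m : ℕ} {L : ℝ≥0}

/-- The map `x ↦ K (f x - y)`, as a bounded continuous function. -/
def shiftComp {K : AgentSpace d → AgentSpace d} (hK : LipschitzWith L K)
    (f : AgentSpace d →ᵇ AgentSpace d) (y : AgentSpace d) : AgentSpace d →ᵇ AgentSpace d :=
  BoundedContinuousFunction.comp K hK (f - BoundedContinuousFunction.const _ y)

@[simp]
theorem shiftComp_apply {K : AgentSpace d → AgentSpace d} (hK : LipschitzWith L K)
    (f : AgentSpace d →ᵇ AgentSpace d) (y x : AgentSpace d) :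
    shiftComp hK f y x = K (f x - y) := rfl

theorem continuous_boundedConst :
    Continuous (BoundedContinuousFunction.const (AgentSpace d) : AgentSpace d → _) := by
  refine LipschitzWith.continuous (K := 1) (LipschitzWith.of_dist_le_mul fun x y => ?_)
  rw [NNReal.coe_one, one_mul]
  exact (BoundedContinuousFunction.dist_le dist_nonneg).2 fun _ => le_rfl

theorem Continuous.shiftComp {X : Type*} [TopologicalSpace X] {K : AgentSpace d → AgentSpace d}
    (hK : LipschitzWith L K) {f : X → (AgentSpace d →ᵇ AgentSpace d)} {y : X → AgentSpace d}
    (hf : Continuous f) (hy : Continuous y) : Continuous fun s => shiftComp hK (f s) (y s) :=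
  (BoundedContinuousFunction.continuous_comp hK).comp
    (hf.sub (continuous_boundedConst.comp hy))

theorem norm_shiftComp_le {K : AgentSpace d → AgentSpace d} (hK : LipschitzWith L K)
    (f : AgentSpace d →ᵇ AgentSpace d) (y : AgentSpace d) :
    ‖shiftComp hK f y‖ ≤ ‖K 0‖ + L * (‖f‖ + ‖y‖) := by
  refine (BoundedContinuousFunction.norm_le (by positivity)).2 fun x => ?_
  rw [shiftComp_apply]
  have h1 := hK.dist_le_mul (f x - y) 0
  rw [dist_eq_norm, dist_zero_right] at h1
  have h2 : L * ‖f x - y‖ ≤ L * (‖f‖ + ‖y‖) := by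
    gcongr
    exact (norm_sub_le _ _).trans (by gcongr; exact f.norm_coe_le_norm x)
  have h3 := norm_le_norm_add_norm_sub (K 0) (K (f x - y))
  rw [norm_sub_rev] at h3
  linarith

variable {H : AgentSpace d → AgentSpace d} {G : Fin d → AgentSpace d → AgentSpace d}

/-- The vector field on flow maps `f` that is induced by the velocity field of `f_# ν`. -/
def flowField (hH : LipschitzWith L H) (hG : ∀ ℓ, LipschitzWith L (G ℓ))
    (ν : Measure (AgentSpace d)) (Y v : Fin m → AgentSpace d)
    (f : AgentSpace d →ᵇ AgentSpace d) : AgentSpace d →ᵇ AgentSpace d :=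
  ∫ z, shiftComp hH f (f z) ∂ν + ∑ ℓ, (m : ℝ)⁻¹ • ∑ k, v k ℓ • shiftComp (hG ℓ) f (Y k)

variable (hH : LipschitzWith L H) (hG : ∀ ℓ, LipschitzWith L (G ℓ)) {ν : Measure (AgentSpace d)}

theorem integrable_shiftComp [IsFiniteMeasure ν] (f : AgentSpace d →ᵇ AgentSpace d) :
    Integrable (fun z => shiftComp hH f (f z)) ν := by
  refine Integrable.of_bound (C := ‖H 0‖ + L * (‖f‖ + ‖f‖))
    (Continuous.shiftComp hH continuous_const f.continuous).aestronglyMeasurable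
    (Eventually.of_forall fun z => (norm_shiftComp_le hH f (f z)).trans ?_)
  gcongr
  exact f.norm_coe_le_norm z

/-- Evaluation at a point is continuous and linear, so it commutes with the Bochner integral. -/
theorem flowField_apply [IsFiniteMeasure ν] (Y v : Fin m → AgentSpace d)
    (f : AgentSpace d →ᵇ AgentSpace d) (x : AgentSpace d) :
    flowField hH hG ν Y v f x = velocity H G (ν.map f) Y v (f x) := by
  have h := ((evalCLM ℝ x : (AgentSpace d →ᵇ AgentSpace d) →L[ℝ] _).integral_comp_comm
    (integrable_shiftComp hH (ν := ν) f)).symm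
  rw [velocity, convH_map hH.continuous f.continuous.aemeasurable, flowField]
  simp only [BoundedContinuousFunction.add_apply, BoundedContinuousFunction.coe_sum,
    Finset.sum_apply, BoundedContinuousFunction.coe_smul, shiftComp_apply, convG]
  congr 1

/-- The factor `2` arises because a change of flow moves both the particle `f x` and the particles
`f z` that act on it. -/
theorem lipschitzWith_flowField [IsFiniteMeasure ν] (hν : ν.real univ ≤ 1)
    {U : ℝ≥0} (Y : Fin m → AgentSpace d) {v : Fin m → AgentSpace d} (hv : ‖v‖ ≤ U) :
    LipschitzWith (L * 2 + d * (U * L)) (flowField hH hG ν Y v) := by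
  refine LipschitzWith.of_dist_le_mul fun f g => ?_
  refine (BoundedContinuousFunction.dist_le (by positivity)).2 fun x => ?_
  rw [flowField_apply, flowField_apply, dist_eq_norm]
  have hA (h : AgentSpace d →ᵇ AgentSpace d) (hh : ‖h‖ ≤ ‖f‖ + ‖g‖) :
      ∀ᵐ z ∂ν, ‖h z‖ ≤ ‖f‖ + ‖g‖ :=
    Eventually.of_forall fun z => (h.norm_coe_le_norm z).trans hh
  refine (norm_velocity_sub_le hν hH hG f.continuous.aemeasurable g.continuous.aemeasurable
    (hA f (by simp)) (hA g (by simp)) (U := U) (η := 0) (δ := 0) (B := 0) hv (by simp) (by simp)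
    le_rfl (by simp)).trans ?_
  have h1 (z) : ‖f z - g z‖ ≤ dist f g := by
    rw [← dist_eq_norm]; exact BoundedContinuousFunction.dist_coe_le_dist z
  have h2 : ∫ z, ‖f z - g z‖ ∂ν ≤ dist f g := by
    have h := norm_integral_le_of_norm_le_const (μ := ν) (f := fun z => ‖f z - g z‖)
      (C := dist f g) (Eventually.of_forall fun z => by rw [norm_norm]; exact h1 z)
    exact (le_abs_self _).trans (h.trans (mul_le_of_le_one_right dist_nonneg hν))
  push_cast
  calc _ ≤ L * (dist f g + dist f g) + d * (0 + U * (L * (dist f g + 0))) := by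
        gcongr <;> exact h1 x
    _ = _ := by ring

theorem norm_flowField_le [IsFiniteMeasure ν] (hν : ν.real univ ≤ 1)
    {C : ℝ} (hC : 0 ≤ C) (hCH : ∀ ξ, ‖H ξ‖ ≤ C * (1 + ‖ξ‖))
    (hCG : ∀ ℓ ξ, ‖G ℓ ξ‖ ≤ C * (1 + ‖ξ‖)) {U η : ℝ} {Y v : Fin m → AgentSpace d}
    (hv : ‖v‖ ≤ U) (hY : ‖Y‖ ≤ η) (f : AgentSpace d →ᵇ AgentSpace d) :
    ‖flowField hH hG ν Y v f‖ ≤ C * (1 + ‖f‖ + ‖f‖) + d * (U * (C * (1 + ‖f‖ + η))) := by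
  have hU0 := (norm_nonneg _).trans hv
  have hη0 := (norm_nonneg _).trans hY
  refine (BoundedContinuousFunction.norm_le (by positivity)).2 fun x => ?_
  rw [flowField_apply]
  refine (norm_velocity_le hν hH.continuous hC hCH hCG f.continuous.aemeasurable (norm_nonneg f)
    (Eventually.of_forall fun z => f.norm_coe_le_norm z) hv hY).trans ?_
  have := f.norm_coe_le_norm x
  gcongr

/-- The space of bounded continuous maps need not be separable, so strong measurability is obtained
by combining continuous curves of maps with the measurable coordinates of the control. -/
theorem aestronglyMeasurable_flowField [IsFiniteMeasure ν] (hν : ν.real univ ≤ 1)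
    {Y v : ℝ → Fin m → AgentSpace d} (hY : Continuous Y) (hv : StronglyMeasurable v)
    {f : ℝ → (AgentSpace d →ᵇ AgentSpace d)} (hf : Continuous f) (κ : Measure ℝ) :
    AEStronglyMeasurable (fun s => flowField hH hG ν (Y s) (v s) (f s)) κ := by
  simp only [flowField]
  refine AEStronglyMeasurable.add ?_ ?_
  -- With no leaders (`m := 0`) only the `H` term survives, so its continuity in `f` is a case of
  -- the Lipschitz estimate.
  · have h := (lipschitzWith_flowField hH hG hν (U := 0) (m := 0) 0 (v := 0) (by simp)).continuous
    have e : (fun s => ∫ z, shiftComp hH (f s) (f s z) ∂ν) =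
        fun s => flowField hH hG ν (m := 0) 0 0 (f s) := by
      funext s
      simp [flowField]
    rw [e]
    exact (h.comp hf).aestronglyMeasurable
  · refine Finset.aestronglyMeasurable_fun_sum _ fun ℓ _ => AEStronglyMeasurable.fun_const_smul ?_ _
    refine Finset.aestronglyMeasurable_fun_sum _ fun k _ => AEStronglyMeasurable.fun_smul ?_ ?_
    · have : Continuous fun w : Fin m → AgentSpace d => w k ℓ := by fun_prop
      exact (this.comp_stronglyMeasurable hv).aestronglyMeasurable
    · exact (Continuous.shiftComp (hG ℓ) hf ((continuous_apply k).comp hY)).aestronglyMeasurable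

/-- `Φ` is the flow, started at `x₀`, of the velocity field that it generates by transporting `ν`. -/
structure IsFlow (T : ℝ) (ν : Measure (AgentSpace d)) (Y v : ℝ → Fin m → AgentSpace d)
    (x₀ : AgentSpace d →ᵇ AgentSpace d) (Φ : ℝ → (AgentSpace d →ᵇ AgentSpace d)) : Prop where
  continuous : Continuous Φ
  eq_integral : ∀ t ∈ Icc 0 T,
    Φ t = x₀ + ∫ s in (0 : ℝ)..t, flowField hH hG ν (Y s) (v s) (Φ s)

variable {T : ℝ} {Y v : ℝ → Fin m → AgentSpace d} {x₀ : AgentSpace d →ᵇ AgentSpace d}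
  {Φ : ℝ → (AgentSpace d →ᵇ AgentSpace d)} {U : ℝ≥0} {η C : ℝ}

theorem exists_isFlow [IsFiniteMeasure ν] (hν : ν.real univ ≤ 1) (hT : 0 ≤ T)
    (hY : Continuous Y) (hYη : ∀ s ∈ Icc 0 T, ‖Y s‖ ≤ η) (hv : StronglyMeasurable v)
    (hvU : ∀ s, ‖v s‖ ≤ U) (hC : 0 ≤ C) (hCH : ∀ ξ, ‖H ξ‖ ≤ C * (1 + ‖ξ‖))
    (hCG : ∀ ℓ ξ, ‖G ℓ ξ‖ ≤ C * (1 + ‖ξ‖)) (x₀ : AgentSpace d →ᵇ AgentSpace d) :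
    ∃ Φ, IsFlow hH hG T ν Y v x₀ Φ := by
  obtain ⟨Φ, h1, h2⟩ := exists_eq_integral_of_lipschitz
    (F := fun s f => flowField hH hG ν (Y s) (v s) f) hT
    (fun s _ => lipschitzWith_flowField hH hG hν (Y s) (hvU s))
    (fun s hs => norm_flowField_le hH hG hν hC hCH hCG (hvU s) (hYη s hs) 0)
    (fun x hx => aestronglyMeasurable_flowField hH hG hν hY hv hx _) x₀
  exact ⟨Φ, h1, h2⟩

/-- A bound for flows that depends on the growth of the kernels only. -/
def flowBound (d : ℕ) (C U η T c : ℝ) : ℝ :=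
  (c + T * (C + d * (U * (C * (1 + η))))) * Real.exp ((2 * C + d * (U * C)) * T)

variable {hH hG}

theorem IsFlow.aestronglyMeasurable [IsFiniteMeasure ν] (hΦ : IsFlow hH hG T ν Y v x₀ Φ)
    (hν : ν.real univ ≤ 1) (hY : Continuous Y) (hv : StronglyMeasurable v) (κ : Measure ℝ) :
    AEStronglyMeasurable (fun s => flowField hH hG ν (Y s) (v s) (Φ s)) κ :=
  aestronglyMeasurable_flowField hH hG hν hY hv hΦ.continuous κ

/-- Growth gives `‖field‖ ≤ α + β * ‖Φ‖`, and Grönwall concludes. The constant `L` does not enter,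
which permits choosing the truncation radius after this bound. -/
theorem IsFlow.norm_le [IsFiniteMeasure ν] (hΦ : IsFlow hH hG T ν Y v x₀ Φ)
    (hν : ν.real univ ≤ 1) (hYη : ∀ s ∈ Icc 0 T, ‖Y s‖ ≤ η)
    (hvU : ∀ s, ‖v s‖ ≤ U) (hC : 0 ≤ C) (hCH : ∀ ξ, ‖H ξ‖ ≤ C * (1 + ‖ξ‖))
    (hCG : ∀ ℓ ξ, ‖G ℓ ξ‖ ≤ C * (1 + ‖ξ‖)) {c : ℝ} (hc : ‖x₀‖ ≤ c) :
    ∀ t ∈ Icc 0 T, ‖Φ t‖ ≤ flowBound d C U η T c := by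
  intro t ht
  have hη0 := (norm_nonneg _).trans (hYη t ht)
  have hc0 := (norm_nonneg _).trans hc
  have hT0 := ht.1.trans ht.2
  set α := C + d * (U * (C * (1 + η))) with hα
  have hα0 : 0 ≤ α := by positivity
  set β := 2 * C + d * (U * C) with hβ
  have hβ0 : 0 ≤ β := by positivity
  have key := le_mul_exp_of_le_add_integral (T := T) (a := c + T * α) (b := β) hβ0
    (f := fun t => ‖Φ t‖) hΦ.continuous.norm.continuousOn (fun t ht => ?_) t ht
  · refine key.trans ?_
    rw [flowBound]
    have := ht.2
    gcongr
  · have hci : Continuous fun s => β * ‖Φ s‖ := hΦ.continuous.norm.const_mul β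
    rw [hΦ.eq_integral t ht]
    have h1 : ‖∫ s in (0 : ℝ)..t, flowField hH hG ν (Y s) (v s) (Φ s)‖ ≤
        ∫ s in (0 : ℝ)..t, (α + β * ‖Φ s‖) := by
      refine intervalIntegral.norm_integral_le_of_norm_le ht.1 (Eventually.of_forall fun s hs => ?_)
        ((continuous_const.add hci).intervalIntegrable _ _)
      have hs' : s ∈ Icc 0 T := ⟨hs.1.le, hs.2.trans ht.2⟩
      refine (norm_flowField_le hH hG hν hC hCH hCG (hvU s) (hYη s hs') (Φ s)).trans_eq ?_
      rw [hα, hβ]; ring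
    rw [intervalIntegral.integral_add (by simp) (hci.intervalIntegrable _ _),
      intervalIntegral.integral_const, smul_eq_mul, sub_zero] at h1
    have h2 : t * α ≤ T * α := by gcongr; exact ht.2
    exact (norm_add_le _ _).trans (by linarith)

theorem IsFlow.exists_bound [IsFiniteMeasure ν] (hΦ : IsFlow hH hG T ν Y v x₀ Φ)
    (hν : ν.real univ ≤ 1) (hYη : ∀ s ∈ Icc 0 T, ‖Y s‖ ≤ η)
    (hvU : ∀ s, ‖v s‖ ≤ U) (hC : 0 ≤ C) (hCH : ∀ ξ, ‖H ξ‖ ≤ C * (1 + ‖ξ‖))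
    (hCG : ∀ ℓ ξ, ‖G ℓ ξ‖ ≤ C * (1 + ‖ξ‖)) :
    ∃ B : ℝ≥0, ∀ᵐ s ∂(volume.restrict (Icc 0 T)),
      ‖flowField hH hG ν (Y s) (v s) (Φ s)‖ ≤ B := by
  obtain ⟨A, hA⟩ := isCompact_Icc.exists_bound_of_continuousOn
    (hΦ.continuous.continuousOn (s := Icc 0 T))
  refine ⟨Real.toNNReal (C * (1 + A + A) + d * (U * (C * (1 + A + η)))), ?_⟩
  filter_upwards [ae_restrict_mem measurableSet_Icc] with s hs
  refine (norm_flowField_le hH hG hν hC hCH hCG (hvU s) (hYη s hs) (Φ s)).trans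
    (le_trans ?_ (Real.le_coe_toNNReal _))
  have := hA s hs
  gcongr

end FlowField

/-! ### Dobrushin stability of flows along a coupling -/

section Stability

variable {d m : ℕ} {L : ℝ≥0} {H : AgentSpace d → AgentSpace d}
  {G : Fin d → AgentSpace d → AgentSpace d} {hH : LipschitzWith L H}
  {hG : ∀ ℓ, LipschitzWith L (G ℓ)} {ν ν' : Measure (AgentSpace d)} {T : ℝ}
  {Y v Y' v' : ℝ → Fin m → AgentSpace d} {x₀ : AgentSpace d →ᵇ AgentSpace d}
  {Φ Φ' : ℝ → (AgentSpace d →ᵇ AgentSpace d)} {U : ℝ≥0} {η C A δ : ℝ}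

/-- The Lipschitz constant in the stability estimate for flows. -/
def stabilityConst (d : ℕ) (L U : ℝ≥0) (C A η T : ℝ) : ℝ :=
  Real.exp ((L + d * (U * L)) * T) * (1 + T * (d * (C * (1 + A + η) + U * (L * T)))) *
    Real.exp (Real.exp ((L + d * (U * L)) * T) * L * T)

/-- Under `π`, both transported measures are images of one measure, by `f p.1` and `f' p.2`. The
control error meets the growth bound `C * (1 + A + η)` of the kernels. -/
theorem norm_flowField_apply_sub_le {π : Measure (AgentSpace d × AgentSpace d)}
    [IsFiniteMeasure π] (hπ : π.real univ ≤ 1) (hπν : π.map Prod.fst = ν)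
    (hπν' : π.map Prod.snd = ν') (hC : 0 ≤ C) (hCG : ∀ ℓ ξ, ‖G ℓ ξ‖ ≤ C * (1 + ‖ξ‖))
    {f f' : AgentSpace d →ᵇ AgentSpace d} {y w y' w' : Fin m → AgentSpace d} (hw : ‖w'‖ ≤ U)
    (hf : ‖f‖ ≤ A) (hf' : ‖f'‖ ≤ A) (hy : ‖y‖ ≤ η) (_hT : 0 ≤ T) (hyy : ‖y - y'‖ ≤ T * δ)
    (hww : ‖w - w'‖ ≤ δ) (x x' : AgentSpace d) :
    ‖flowField hH hG ν y w f x - flowField hH hG ν' y' w' f' x'‖ ≤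
      (L + d * (U * L)) * ‖f x - f' x'‖ + (L * ∫ p, ‖f p.1 - f' p.2‖ ∂π) +
        (d * (C * (1 + A + η) + U * (L * T))) * δ := by
  have hδ := (norm_nonneg _).trans hww
  have hA := (norm_nonneg _).trans hf
  have hη := (norm_nonneg _).trans hy
  subst hπν hπν'
  rw [flowField_apply, flowField_apply, Measure.map_map f.continuous.measurable measurable_fst,
    Measure.map_map f'.continuous.measurable measurable_snd]
  refine (norm_velocity_sub_le hπ hH hG (A := A) (η := T * δ) (δ := δ)
    (B := δ * (C * (1 + A + η)))
    (f.continuous.measurable.comp measurable_fst).aemeasurable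
    (f'.continuous.measurable.comp measurable_snd).aemeasurable
    (Eventually.of_forall fun p => (f.norm_coe_le_norm _).trans hf)
    (Eventually.of_forall fun p => (f'.norm_coe_le_norm _).trans hf')
    hw hyy hww (by positivity) fun ℓ k => ?_).trans_eq ?_
  · gcongr
    refine (hCG _ _).trans ?_
    rw [add_assoc]
    gcongr
    exact (norm_sub_le _ _).trans
      (add_le_add ((f.norm_coe_le_norm _).trans hf) ((norm_le_pi_norm y k).trans hy))
  · simp only [Function.comp_apply]
    ring

theorem IsFlow.apply_eq_integral [IsFiniteMeasure ν] (hΦ : IsFlow hH hG T ν Y v x₀ Φ)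
    (hν : ν.real univ ≤ 1) (hY : Continuous Y) (hYη : ∀ s ∈ Icc 0 T, ‖Y s‖ ≤ η)
    (hv : StronglyMeasurable v) (hvU : ∀ s, ‖v s‖ ≤ U) (hC : 0 ≤ C)
    (hCH : ∀ ξ, ‖H ξ‖ ≤ C * (1 + ‖ξ‖)) (hCG : ∀ ℓ ξ, ‖G ℓ ξ‖ ≤ C * (1 + ‖ξ‖)) {t : ℝ}
    (ht : t ∈ Icc 0 T) (x : AgentSpace d) :
    IntervalIntegrable (fun s => flowField hH hG ν (Y s) (v s) (Φ s) x) volume 0 t ∧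
      Φ t x = x₀ x + ∫ s in (0 : ℝ)..t, flowField hH hG ν (Y s) (v s) (Φ s) x := by
  obtain ⟨B, hB⟩ := hΦ.exists_bound hν hYη hvU hC hCH hCG
  have hI := intervalIntegrable_of_bound (hΦ.aestronglyMeasurable hν hY hv _) hB
    ⟨le_rfl, ht.1.trans ht.2⟩ ht
  let e : (AgentSpace d →ᵇ AgentSpace d) →L[ℝ] AgentSpace d := evalCLM ℝ x
  refine ⟨⟨e.integrable_comp hI.1, e.integrable_comp hI.2⟩, ?_⟩
  rw [show Φ t x = e (Φ t) from rfl, hΦ.eq_integral t ht, map_add,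
    ← e.intervalIntegral_comp_comm hI]
  rfl

/-- Stability of flows with respect to the initial measure and the control. -/
theorem IsFlow.integral_norm_sub_le [IsFiniteMeasure ν] [IsFiniteMeasure ν']
    (hν : ν.real univ ≤ 1) (hν' : ν'.real univ ≤ 1)
    (hΦ : IsFlow hH hG T ν Y v x₀ Φ) (hΦ' : IsFlow hH hG T ν' Y' v' x₀ Φ')
    (hY : Continuous Y) (hY' : Continuous Y')
    (hYη : ∀ s ∈ Icc 0 T, ‖Y s‖ ≤ η) (hYη' : ∀ s ∈ Icc 0 T, ‖Y' s‖ ≤ η)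
    (hv : StronglyMeasurable v) (hv' : StronglyMeasurable v')
    (hvU : ∀ s, ‖v s‖ ≤ U) (hvU' : ∀ s, ‖v' s‖ ≤ U) (hC : 0 ≤ C)
    (hCH : ∀ ξ, ‖H ξ‖ ≤ C * (1 + ‖ξ‖)) (hCG : ∀ ℓ ξ, ‖G ℓ ξ‖ ≤ C * (1 + ‖ξ‖))
    (hA : ∀ s ∈ Icc 0 T, ‖Φ s‖ ≤ A) (hA' : ∀ s ∈ Icc 0 T, ‖Φ' s‖ ≤ A) (hδ : 0 ≤ δ)
    (hYY : ∀ s ∈ Icc 0 T, ‖Y s - Y' s‖ ≤ T * δ)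
    (hvv : ∀ᵐ s ∂(volume.restrict (Icc 0 T)), ‖v s - v' s‖ ≤ δ)
    {π : Measure (AgentSpace d × AgentSpace d)}
    (hπν : π.map Prod.fst = ν) (hπν' : π.map Prod.snd = ν') {t : ℝ} (ht : t ∈ Icc 0 T) :
    ∫ p, ‖Φ t p.1 - Φ' t p.2‖ ∂π ≤
      stabilityConst d L U C A η T * ((∫ p, ‖x₀ p.1 - x₀ p.2‖ ∂π) + δ) := by
  have hT : 0 ≤ T := ht.1.trans ht.2
  have hA0 := (norm_nonneg _).trans (hA t ht)
  have hη0 := (norm_nonneg _).trans (hYη t ht)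
  have hmass : π univ = ν univ := by
    rw [← hπν, Measure.map_apply measurable_fst MeasurableSet.univ, preimage_univ]
  have : IsFiniteMeasure π := ⟨by rw [hmass]; exact measure_lt_top ν _⟩
  have hπ : π.real univ ≤ 1 := by rw [measureReal_def, hmass]; exact hν
  set a : ℝ := L + d * (U * L) with ha
  have ha0 : 0 ≤ a := by positivity
  set ε : ℝ := (d * (C * (1 + A + η) + U * (L * T))) with hε
  have hε0 : 0 ≤ ε := by positivity
  set D : ℝ → ℝ := fun t => ∫ p, ‖Φ t p.1 - Φ' t p.2‖ ∂π with hD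
  have hmeas (f f' : AgentSpace d →ᵇ AgentSpace d) :
      AEStronglyMeasurable (fun p : AgentSpace d × AgentSpace d => ‖f p.1 - f' p.2‖) π :=
    (((f.continuous.comp continuous_fst).sub
      (f'.continuous.comp continuous_snd)).norm).aestronglyMeasurable
  have hbd (f f' : AgentSpace d →ᵇ AgentSpace d) (p : AgentSpace d × AgentSpace d) :
      ‖‖f p.1 - f' p.2‖‖ ≤ ‖f‖ + ‖f'‖ := by
    rw [norm_norm]
    exact (norm_sub_le _ _).trans (add_le_add (f.norm_coe_le_norm _) (f'.norm_coe_le_norm _))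
  have hint (f f' : AgentSpace d →ᵇ AgentSpace d) :
      Integrable (fun p : AgentSpace d × AgentSpace d => ‖f p.1 - f' p.2‖) π :=
    Integrable.of_bound (hmeas f f') _ (Eventually.of_forall (hbd f f'))
  have hDc : ContinuousOn D (Icc 0 T) := by
    refine continuousOn_of_dominated (bound := fun _ => A + A) (fun s _ => hmeas _ _)
      (fun s hs => Eventually.of_forall fun p => (hbd _ _ p).trans
        (add_le_add (hA s hs) (hA' s hs))) (integrable_const _)
      (Eventually.of_forall fun p => ?_)
    have h1 : Continuous fun s => Φ s p.1 := (evalCLM ℝ p.1).continuous.comp hΦ.continuous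
    have h2 : Continuous fun s => Φ' s p.2 := (evalCLM ℝ p.2).continuous.comp hΦ'.continuous
    exact (h1.sub h2).norm.continuousOn
  have hD0 (s) : 0 ≤ D s := integral_nonneg fun _ => norm_nonneg _
  have hDI {s t : ℝ} (hs : s ∈ Icc 0 T) (ht : t ∈ Icc 0 T) :
      IntervalIntegrable D volume s t :=
    (hDc.mono ((convex_Icc (0 : ℝ) T).ordConnected.uIcc_subset hs ht)).intervalIntegrable
  have h0T : (0 : ℝ) ∈ Icc 0 T := ⟨le_rfl, hT⟩
  set E := Real.exp (a * T) with hE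
  -- First Grönwall argument: the pair `p` is fixed and the averaged distance `D` acts as a source.
  -- Integrating the resulting bound over `π` needs no interchange of time and space integrals.
  have hptw : ∀ t ∈ Icc 0 T, ∀ p : AgentSpace d × AgentSpace d,
      ‖Φ t p.1 - Φ' t p.2‖ ≤
        (‖x₀ p.1 - x₀ p.2‖ + (T * (ε * δ) + ∫ s in (0 : ℝ)..t, L * D s)) * E := by
    intro t ht p
    have hc : Continuous fun s => ‖Φ s p.1 - Φ' s p.2‖ :=
      (((evalCLM ℝ p.1).continuous.comp hΦ.continuous).sub
        ((evalCLM ℝ p.2).continuous.comp hΦ'.continuous)).norm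
    have hnn : ∀ τ ∈ Icc 0 T, 0 ≤ ∫ s in (0 : ℝ)..τ, L * D s := fun τ hτ =>
      intervalIntegral.integral_nonneg hτ.1 fun s _ => mul_nonneg L.2 (hD0 s)
    -- The source is frozen at its value for the final time `t`, which dominates that at every
    -- earlier `τ`; Grönwall then has a constant inhomogeneity on `[0,t]`.
    have key := le_mul_exp_of_le_add_integral (T := t) (b := a)
      (a := ‖x₀ p.1 - x₀ p.2‖ + (T * (ε * δ) + ∫ s in (0 : ℝ)..t, L * D s)) ha0
      (f := fun s => ‖Φ s p.1 - Φ' s p.2‖) hc.continuousOn (fun τ hτ => ?_) t ⟨ht.1, le_rfl⟩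
    · refine key.trans ?_
      have := hnn t ht
      gcongr
      exact Real.exp_le_exp.2 (mul_le_mul_of_nonneg_left ht.2 ha0)
    · have hτT : τ ∈ Icc 0 T := ⟨hτ.1, hτ.2.trans ht.2⟩
      obtain ⟨i1, e1⟩ := hΦ.apply_eq_integral hν hY hYη hv hvU hC hCH hCG hτT p.1
      obtain ⟨i2, e2⟩ := hΦ'.apply_eq_integral hν' hY' hYη' hv' hvU' hC hCH hCG hτT p.2
      have ic : IntervalIntegrable (fun s => a * ‖Φ s p.1 - Φ' s p.2‖) volume 0 τ :=
        (hc.const_mul a).intervalIntegrable _ _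
      have iD : IntervalIntegrable (fun s => L * D s) volume 0 τ := (hDI h0T hτT).const_mul _
      have h1 : ‖∫ s in (0 : ℝ)..τ, (flowField hH hG ν (Y s) (v s) (Φ s) p.1 -
          flowField hH hG ν' (Y' s) (v' s) (Φ' s) p.2)‖ ≤
          ∫ s in (0 : ℝ)..τ, (a * ‖Φ s p.1 - Φ' s p.2‖ + L * D s + ε * δ) := by
        refine intervalIntegral.norm_integral_le_of_norm_le hτ.1 ?_
          ((ic.add iD).add intervalIntegrable_const)
        rw [ae_restrict_iff' measurableSet_Icc] at hvv
        filter_upwards [hvv] with s hs hsm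
        have hsT : s ∈ Icc 0 T := ⟨hsm.1.le, hsm.2.trans hτT.2⟩
        exact norm_flowField_apply_sub_le hπ hπν hπν' hC hCG (hvU' s) (hA s hsT) (hA' s hsT)
          (hYη s hsT) hT (hYY s hsT) (hs hsT) p.1 p.2
      rw [intervalIntegral.integral_add (ic.add iD) intervalIntegrable_const,
        intervalIntegral.integral_add ic iD, intervalIntegral.integral_const, smul_eq_mul,
        sub_zero] at h1
      have h2 : ∫ s in (0 : ℝ)..τ, L * D s ≤ ∫ s in (0 : ℝ)..t, L * D s := by
        rw [← intervalIntegral.integral_add_adjacent_intervals iD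
          ((hDI hτT ht).const_mul _), le_add_iff_nonneg_right]
        exact intervalIntegral.integral_nonneg hτ.2 fun s _ => mul_nonneg L.2 (hD0 s)
      have h3 : τ * (ε * δ) ≤ T * (ε * δ) := by
        gcongr
        exact hτT.2
      rw [e1, e2, add_sub_add_comm, ← intervalIntegral.integral_sub i1 i2]
      exact (norm_add_le _ _).trans (by linarith)
  set D₀ := ∫ p, ‖x₀ p.1 - x₀ p.2‖ ∂π with hD₀
  have hD₀0 : 0 ≤ D₀ := integral_nonneg fun _ => norm_nonneg _
  -- Averaging the pointwise bound closes the inequality for `D`; the second Grönwall argument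
  -- yields the last exponential of `stabilityConst`.
  have hDle : ∀ t ∈ Icc 0 T,
      D t ≤ E * (D₀ + T * (ε * δ)) + ∫ s in (0 : ℝ)..t, (E * L) * D s := by
    intro t ht
    have h1 : D t ≤ ∫ p, (‖x₀ p.1 - x₀ p.2‖ +
        (T * (ε * δ) + ∫ s in (0 : ℝ)..t, L * D s)) * E ∂π :=
      integral_mono (hint _ _) (((hint _ _).add (integrable_const _)).mul_const _) (hptw t ht)
    rw [integral_mul_const, integral_add (hint _ _) (integrable_const _), integral_const,
      smul_eq_mul] at h1
    have hnn : 0 ≤ ∫ s in (0 : ℝ)..t, L * D s :=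
      intervalIntegral.integral_nonneg ht.1 fun s _ => mul_nonneg L.2 (hD0 s)
    have h2 : π.real univ * (T * (ε * δ) + ∫ s in (0 : ℝ)..t, L * D s) ≤
        T * (ε * δ) + ∫ s in (0 : ℝ)..t, L * D s :=
      mul_le_of_le_one_left (by positivity) hπ
    simp only [mul_assoc E, intervalIntegral.integral_const_mul] at hnn h1 h2 ⊢
    refine h1.trans ?_
    have hE0 : 0 ≤ E := (Real.exp_pos _).le
    calc _ ≤ (D₀ + (T * (ε * δ) + L * ∫ s in (0 : ℝ)..t, D s)) * E := by gcongr
      _ = _ := by ring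
  have := le_mul_exp_of_le_add_integral (by positivity) hDc hDle t ht
  refine this.trans ?_
  have h1 : D₀ + T * (ε * δ) ≤ (1 + T * ε) * (D₀ + δ) := by
    have : 0 ≤ T * ε * D₀ := by positivity
    nlinarith
  rw [stabilityConst, ← ha, ← hε, ← hE]
  calc E * (D₀ + T * (ε * δ)) * Real.exp (E * L * t)
      ≤ E * ((1 + T * ε) * (D₀ + δ)) * Real.exp (E * L * T) := by
        have := ht.2
        gcongr
    _ = _ := by ring

end Stability

/-! ### Controls and leader trajectories -/

section Leaders

theorem HasCaratheodoryDeriv.congr_ae {F : Type*} [NormedAddCommGroup F] [NormedSpace ℝ F] {T : ℝ}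
    {y w w' : ℝ → F} (h : HasCaratheodoryDeriv T y w)
    (hw : w =ᵐ[volume.restrict (Icc 0 T)] w') : HasCaratheodoryDeriv T y w' := by
  refine ⟨h.absolutelyContinuous, ?_⟩
  filter_upwards [h.ae_hasDerivAt, hw] with t h1 h2
  rwa [← h2]

theorem hasCaratheodoryDeriv_clm_comp_of_eq_integral {E F : Type*} [NormedAddCommGroup E]
    [NormedSpace ℝ E] [CompleteSpace E] [NormedAddCommGroup F] [NormedSpace ℝ F] {T : ℝ}
    (A : E →L[ℝ] F) {B : ℝ≥0} {x g : ℝ → E}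
    (hg : AEStronglyMeasurable g (volume.restrict (Icc 0 T)))
    (hB : ∀ᵐ s ∂(volume.restrict (Icc 0 T)), ‖g s‖ ≤ B) (x₀ : E) (hT : 0 ≤ T)
    (hx : ∀ t ∈ Icc 0 T, x t = x₀ + ∫ s in (0 : ℝ)..t, g s) :
    HasCaratheodoryDeriv T (fun t => A (x t)) (fun t => A (g t)) := by
  constructor
  · have h := A.lipschitz.comp_lipschitzOnWith (lipschitzOnWith_of_eq_integral hg hB x₀ hx)
    rw [← uIcc_of_le hT] at h
    exact h.absolutelyContinuousOnInterval
  · filter_upwards [(hasCaratheodoryDeriv_of_eq_integral hg hB x₀ hT hx).ae_hasDerivAt] with t ht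
    exact A.hasFDerivAt.comp_hasDerivAt t ht

variable {d m : ℕ} {T : ℝ}

/-- A control has a version with values in the compact set everywhere. -/
theorem IsControl.exists_version {𝒰 : Set (Fin m → AgentSpace d)} {u : ℝ → Fin m → AgentSpace d}
    (hu : IsControl T 𝒰 u) (h𝒰 : IsCompact 𝒰) (h𝒰ne : 𝒰.Nonempty) :
    ∃ v : ℝ → Fin m → AgentSpace d, StronglyMeasurable v ∧ (∀ s, v s ∈ 𝒰) ∧
      v =ᵐ[volume.restrict (Icc 0 T)] u := by
  classical
  obtain ⟨c, hc⟩ := h𝒰ne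
  have hm := hu.measurable.stronglyMeasurable_mk
  refine ⟨fun s => if hu.measurable.mk u s ∈ 𝒰 then hu.measurable.mk u s else c,
    StronglyMeasurable.ite (hm.measurable h𝒰.measurableSet) hm stronglyMeasurable_const,
    fun s => ?_, ?_⟩
  · dsimp only
    split_ifs with h
    exacts [h, hc]
  · filter_upwards [hu.measurable.ae_eq_mk, hu.mem] with s h1 h2
    rw [← h1, if_pos h2]

/-- The trajectories of the leaders. -/
def leaders (Y₀ : Fin m → AgentSpace d) (v : ℝ → Fin m → AgentSpace d) (t : ℝ) :
    Fin m → AgentSpace d :=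
  Y₀ + ∫ s in (0 : ℝ)..t, v s

variable {U : ℝ≥0} {v v' : ℝ → Fin m → AgentSpace d} (Y₀ : Fin m → AgentSpace d)

theorem intervalIntegrable_control (hv : StronglyMeasurable v) (hvU : ∀ s, ‖v s‖ ≤ U) (a b : ℝ) :
    IntervalIntegrable v volume a b :=
  ⟨Integrable.of_bound hv.aestronglyMeasurable U (Eventually.of_forall hvU),
    Integrable.of_bound hv.aestronglyMeasurable U (Eventually.of_forall hvU)⟩

theorem continuous_leaders (hv : StronglyMeasurable v) (hvU : ∀ s, ‖v s‖ ≤ U) :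
    Continuous (leaders Y₀ v) :=
  continuous_const.add
    (intervalIntegral.continuous_primitive (intervalIntegrable_control hv hvU) 0)

theorem norm_leaders_le (hvU : ∀ s, ‖v s‖ ≤ U) {t : ℝ} (ht : t ∈ Icc 0 T) :
    ‖leaders Y₀ v t‖ ≤ ‖Y₀‖ + T * U := by
  refine (norm_add_le _ _).trans ?_
  gcongr
  refine (intervalIntegral.norm_integral_le_of_norm_le_const (C := U) fun s _ => hvU s).trans ?_
  rw [sub_zero, abs_of_nonneg ht.1, mul_comm]
  gcongr
  exact ht.2

theorem norm_leaders_sub_le (hv : StronglyMeasurable v) (hvU : ∀ s, ‖v s‖ ≤ U)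
    (hv' : StronglyMeasurable v') (hvU' : ∀ s, ‖v' s‖ ≤ U) {δ : ℝ} (hδ : 0 ≤ δ)
    (hvv : ∀ᵐ s ∂(volume.restrict (Icc 0 T)), ‖v s - v' s‖ ≤ δ) {t : ℝ} (ht : t ∈ Icc 0 T) :
    ‖leaders Y₀ v t - leaders Y₀ v' t‖ ≤ T * δ := by
  rw [leaders, leaders, add_sub_add_left_eq_sub, ← intervalIntegral.integral_sub
    (intervalIntegrable_control hv hvU _ _) (intervalIntegrable_control hv' hvU' _ _)]
  refine (intervalIntegral.norm_integral_le_of_norm_le_const_ae (C := δ) ?_).trans ?_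
  · rw [ae_restrict_iff' measurableSet_Icc] at hvv
    filter_upwards [hvv] with s hs hsm
    rw [uIoc_of_le ht.1] at hsm
    exact hs ⟨hsm.1.le, hsm.2.trans ht.2⟩
  · rw [sub_zero, abs_of_nonneg ht.1, mul_comm]
    gcongr
    exact ht.2

theorem hasCaratheodoryDeriv_leaders (hT : 0 ≤ T) (hv : StronglyMeasurable v)
    (hvU : ∀ s, ‖v s‖ ≤ U) (k : Fin m) :
    HasCaratheodoryDeriv T (fun t => leaders Y₀ v t k) (fun t => v t k) :=
  hasCaratheodoryDeriv_clm_comp_of_eq_integral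
    (ContinuousLinearMap.proj (R := ℝ) (φ := fun _ : Fin m => AgentSpace d) k)
    hv.aestronglyMeasurable (Eventually.of_forall hvU) Y₀ hT (fun _ _ => rfl)

end Leaders

/-! ### The finite system: existence from a flow, and uniqueness -/

section FiniteSystem

variable {d m N : ℕ}

/-- The uniform measure on the labels of the particles. -/
def labelMeasure (N : ℕ) : Measure (Fin N) :=
  (N : ℝ≥0∞)⁻¹ • ∑ i, Measure.dirac i

/-- The mass is one except for `N = 0`, when the measure vanishes. The flow estimates therefore ask
for mass at most one instead of a probability measure. -/
theorem isFiniteMeasure_labelMeasure (N : ℕ) :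
    IsFiniteMeasure (labelMeasure N) ∧ (labelMeasure N).real univ ≤ 1 := by
  have h : labelMeasure N univ ≤ 1 := by
    simp only [labelMeasure, Measure.smul_apply, Measure.finsetSum_apply, measure_univ,
      Finset.sum_const, Finset.card_univ, Fintype.card_fin, nsmul_eq_mul, mul_one, smul_eq_mul]
    exact ENNReal.inv_mul_le_one _
  exact ⟨⟨h.trans_lt ENNReal.one_lt_top⟩, ENNReal.toReal_le_of_le_ofReal zero_le_one (by simpa)⟩

theorem empirical_eq_map (X : Fin N → AgentSpace d) : empirical X = (labelMeasure N).map X := by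
  have hX : Measurable X := measurable_of_finite X
  simp only [empirical, labelMeasure, Measure.map_smul]
  rw [← Measure.mapₗ_apply_of_measurable hX, map_sum]
  simp only [Measure.mapₗ_apply_of_measurable hX, Measure.map_dirac' hX]

theorem isFiniteMeasure_empirical (X : Fin N → AgentSpace d) : IsFiniteMeasure (empirical X) ∧
    (empirical X).real univ ≤ 1 := by
  obtain ⟨_, h⟩ := isFiniteMeasure_labelMeasure N
  rw [empirical_eq_map]
  refine ⟨inferInstance, ?_⟩
  rwa [map_measureReal_apply (measurable_of_finite X) MeasurableSet.univ, preimage_univ]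

theorem map_empirical {f : AgentSpace d → AgentSpace d} (hf : Measurable f)
    (X : Fin N → AgentSpace d) : (empirical X).map f = empirical fun i => f (X i) := by
  rw [empirical_eq_map, empirical_eq_map, Measure.map_map hf (measurable_of_finite X)]
  rfl

theorem ae_empirical {p : AgentSpace d → Prop} {X : Fin N → AgentSpace d} (h : ∀ i, p (X i)) :
    ∀ᵐ z ∂(empirical X), p z := by
  refine Measure.ae_smul_measure ?_ _
  rw [← Measure.sum_fintype, Measure.ae_sum_iff]
  intro i
  rw [ae_dirac_eq]
  exact h i

variable {L : ℝ≥0} {H H' : AgentSpace d → AgentSpace d}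
  {G G' : Fin d → AgentSpace d → AgentSpace d} {hH' : LipschitzWith L H'}
  {hG' : ∀ ℓ, LipschitzWith L (G' ℓ)} {T : ℝ} {x₀ : AgentSpace d →ᵇ AgentSpace d}
  {u v : ℝ → Fin m → AgentSpace d} {Y₀ : Fin m → AgentSpace d}
  {Φ : ℝ → (AgentSpace d →ᵇ AgentSpace d)} {U : ℝ≥0} {η C r ρ : ℝ}

/-- The flow of the empirical measure yields a solution of the finite system. -/
theorem IsFlow.isFiniteSolution {X₀ : Fin N → AgentSpace d}
    (hΦ : IsFlow hH' hG' T (empirical X₀) (leaders Y₀ v) v x₀ Φ) (hT : 0 ≤ T)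
    (hH : ∀ ξ, ‖ξ‖ ≤ r → H ξ = H' ξ) (hG : ∀ ℓ ξ, ‖ξ‖ ≤ r → G ℓ ξ = G' ℓ ξ)
    (h₁ : ρ + ρ ≤ r) (h₂ : ρ + η ≤ r)
    (hYη : ∀ s ∈ Icc 0 T, ‖leaders Y₀ v s‖ ≤ η)
    (hv : StronglyMeasurable v) (hvU : ∀ s, ‖v s‖ ≤ U) (hvu : v =ᵐ[volume.restrict (Icc 0 T)] u)
    (hC : 0 ≤ C) (hCH : ∀ ξ, ‖H' ξ‖ ≤ C * (1 + ‖ξ‖)) (hCG : ∀ ℓ ξ, ‖G' ℓ ξ‖ ≤ C * (1 + ‖ξ‖))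
    (hρ : ∀ s ∈ Icc 0 T, ‖Φ s‖ ≤ ρ) (hx₀ : ∀ i, x₀ (X₀ i) = X₀ i) :
    IsFiniteSolution H G T u Y₀ X₀ (leaders Y₀ v) (fun t i => Φ t (X₀ i)) := by
  obtain ⟨_, hν⟩ := isFiniteMeasure_empirical X₀
  obtain ⟨B, hB⟩ := hΦ.exists_bound hν hYη hvU hC hCH hCG
  refine ⟨by simp [leaders], ?_, fun k => ?_, fun i => ?_⟩
  · funext i
    rw [hΦ.eq_integral 0 ⟨le_rfl, hT⟩, intervalIntegral.integral_same, add_zero, hx₀]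
  · refine (hasCaratheodoryDeriv_leaders Y₀ hT hv hvU k).congr_ae ?_
    filter_upwards [hvu] with s hs
    rw [hs]
  · refine (hasCaratheodoryDeriv_clm_comp_of_eq_integral
      (evalCLM ℝ (X₀ i) : (AgentSpace d →ᵇ AgentSpace d) →L[ℝ] AgentSpace d)
      (hΦ.aestronglyMeasurable hν (continuous_leaders Y₀ hv hvU) hv _) hB x₀ hT
      hΦ.eq_integral).congr_ae ?_
    filter_upwards [hvu, ae_restrict_mem measurableSet_Icc] with s hs hsT
    change flowField hH' hG' (empirical X₀) (leaders Y₀ v s) (v s) (Φ s) (X₀ i) = _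
    have hb (x) : ‖Φ s x‖ ≤ ρ := ((Φ s).norm_coe_le_norm x).trans (hρ s hsT)
    rw [flowField_apply, map_empirical (Φ s).continuous.measurable, hs]
    exact (velocity_congr hH hG h₁ h₂ (ae_empirical fun i => hb _) (hYη s hsT) (u s) (hb _)).symm

theorem HasCaratheodoryDeriv.continuousOn {F : Type*} [NormedAddCommGroup F] [NormedSpace ℝ F]
    {y w : ℝ → F} (h : HasCaratheodoryDeriv T y w) (hT : 0 ≤ T) : ContinuousOn y (Icc 0 T) := by
  have := h.absolutelyContinuous.continuousOn
  rwa [uIcc_of_le hT] at this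

theorem HasCaratheodoryDeriv.eqOn {F : Type*} [NormedAddCommGroup F] [NormedSpace ℝ F]
    {y y' w : ℝ → F} (h : HasCaratheodoryDeriv T y w) (h' : HasCaratheodoryDeriv T y' w)
    (hT : 0 ≤ T) (h0 : y 0 = y' 0) : EqOn y y' (Icc 0 T) := by
  obtain ⟨c, hc⟩ := (h.absolutelyContinuous.sub h'.absolutelyContinuous).const_of_ae_hasDerivAt_zero
    (by
      rw [uIcc_of_le hT]
      filter_upwards [(ae_restrict_iff' measurableSet_Icc).1 h.ae_hasDerivAt,
        (ae_restrict_iff' measurableSet_Icc).1 h'.ae_hasDerivAt] with t h₁ h₂ ht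
      simpa using (h₁ ht).sub (h₂ ht))
  rw [uIcc_of_le hT] at hc
  intro t ht
  have e₁ := hc t ht
  have e₂ := hc 0 ⟨le_rfl, hT⟩
  simp only [Pi.sub_apply, h0, sub_self] at e₁ e₂
  exact sub_eq_zero.1 (e₁.trans e₂.symm)

theorem KernelHypothesis.exists_truncation (h : KernelHypothesis H G) {r : ℝ} (hr : 0 ≤ r) :
    ∃ L : ℝ≥0, LipschitzWith L (fun ξ => H (clampBox r ξ)) ∧
      ∀ ℓ, LipschitzWith L (fun ξ => G ℓ (clampBox r ξ)) := by
  obtain ⟨L₀, h₀⟩ := h.lipschitz_H.exists_lipschitzWith_comp_clampBox hr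
  choose L₁ h₁ using fun ℓ => (h.lipschitz_G ℓ).exists_lipschitzWith_comp_clampBox hr
  refine ⟨L₀ + ∑ ℓ, L₁ ℓ, h₀.weaken le_self_add, fun ℓ => (h₁ ℓ).weaken ?_⟩
  exact (Finset.single_le_sum (fun _ _ => zero_le) (Finset.mem_univ ℓ)).trans le_add_self

theorem KernelHypothesis.exists_growth (h : KernelHypothesis H G) :
    ∃ C : ℝ, 0 ≤ C ∧ (∀ ξ, ‖H ξ‖ ≤ C * (1 + ‖ξ‖)) ∧ ∀ ℓ ξ, ‖G ℓ ξ‖ ≤ C * (1 + ‖ξ‖) := by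
  obtain ⟨C₀, h₀⟩ := h.growth_H
  choose C₁ h₁ using h.growth_G
  refine ⟨|C₀| + ∑ ℓ, |C₁ ℓ|, by positivity, fun ξ => (h₀ ξ).trans ?_,
    fun ℓ ξ => (h₁ ℓ ξ).trans ?_⟩
  · gcongr
    exact (le_abs_self _).trans (le_add_of_nonneg_right (by positivity))
  · gcongr
    refine (le_abs_self _).trans (le_trans ?_ (le_add_of_nonneg_left (abs_nonneg _)))
    exact Finset.single_le_sum (f := fun ℓ => |C₁ ℓ|) (fun _ _ => abs_nonneg _) (Finset.mem_univ ℓ)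

theorem IsFiniteSolution.continuousOn {X₀ : Fin N → AgentSpace d} {Y : ℝ → Fin m → AgentSpace d}
    {X : ℝ → Fin N → AgentSpace d} (h : IsFiniteSolution H G T u Y₀ X₀ Y X) (hT : 0 ≤ T) :
    ContinuousOn X (Icc 0 T) ∧ ContinuousOn Y (Icc 0 T) :=
  ⟨continuousOn_pi.2 fun i => (h.followers i).continuousOn hT,
    continuousOn_pi.2 fun k => (h.leaders k).continuousOn hT⟩

/-- Uniqueness for the finite system. -/
theorem IsFiniteSolution.eqOn (hHG : KernelHypothesis H G) (hT : 0 ≤ T)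
    (hu : ∀ᵐ t ∂(volume.restrict (Icc 0 T)), ‖u t‖ ≤ U) {X₀ : Fin N → AgentSpace d}
    {Y Y' : ℝ → Fin m → AgentSpace d} {X X' : ℝ → Fin N → AgentSpace d}
    (h : IsFiniteSolution H G T u Y₀ X₀ Y X) (h' : IsFiniteSolution H G T u Y₀ X₀ Y' X') :
    EqOn Y Y' (Icc 0 T) ∧ EqOn X X' (Icc 0 T) := by
  have hYY : EqOn Y Y' (Icc 0 T) := by
    intro t ht
    funext k
    exact (h.leaders k).eqOn (h'.leaders k) hT
      (by simp only [h.initial_leaders, h'.initial_leaders]) ht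
  refine ⟨hYY, ?_⟩
  obtain ⟨hXc, hYc⟩ := h.continuousOn hT
  obtain ⟨hXc', -⟩ := h'.continuousOn hT
  obtain ⟨A, hA⟩ := isCompact_Icc.exists_bound_of_continuousOn hXc
  obtain ⟨A', hA'⟩ := isCompact_Icc.exists_bound_of_continuousOn hXc'
  obtain ⟨η, hη⟩ := isCompact_Icc.exists_bound_of_continuousOn hYc
  have h0 : (0 : ℝ) ∈ Icc 0 T := ⟨le_rfl, hT⟩
  have hA0 := (norm_nonneg _).trans (hA 0 h0)
  have hA0' := (norm_nonneg _).trans (hA' 0 h0)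
  have hη0 := (norm_nonneg _).trans (hη 0 h0)
  -- Both solutions are continuous, hence bounded, on `[0,T]`. All kernel arguments along them have
  -- norm at most `ρ + ρ`, so the kernels may be taken globally Lipschitz.
  set ρ := A + A' + η with hρ
  obtain ⟨L, hLH, hLG⟩ := hHG.exists_truncation (r := ρ + ρ) (by positivity)
  have hHe : ∀ ξ, ‖ξ‖ ≤ ρ + ρ → H ξ = H (clampBox (ρ + ρ) ξ) := fun ξ hξ => by
    rw [clampBox_of_norm_le hξ]
  have hGe : ∀ ℓ ξ, ‖ξ‖ ≤ ρ + ρ → G ℓ ξ = G ℓ (clampBox (ρ + ρ) ξ) := fun ℓ ξ hξ => by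
    rw [clampBox_of_norm_le hξ]
  obtain ⟨_, hP1⟩ := isFiniteMeasure_labelMeasure N
  set K : ℝ := L * 2 + d * (U * L) with hK
  have hK0 : 0 ≤ K := by positivity
  have hvel : ∀ᵐ s ∂(volume.restrict (Icc 0 T)), ∀ i,
      ‖velocity H G (empirical (X s)) (Y s) (u s) (X s i) -
        velocity H G (empirical (X' s)) (Y' s) (u s) (X' s i)‖ ≤ K * ‖X s - X' s‖ := by
    filter_upwards [hu, ae_restrict_mem measurableSet_Icc] with s hs hsT i
    have b (j) : ‖X s j‖ ≤ ρ := (norm_le_pi_norm _ j).trans ((hA s hsT).trans (by linarith))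
    have b' (j) : ‖X' s j‖ ≤ ρ := (norm_le_pi_norm _ j).trans ((hA' s hsT).trans (by linarith))
    have hYρ : ‖Y s‖ ≤ ρ := (hη s hsT).trans (by linarith)
    rw [← hYY hsT, velocity_congr hHe hGe le_rfl le_rfl (ae_empirical b) hYρ (u s) (b i),
      velocity_congr hHe hGe le_rfl le_rfl (ae_empirical b') hYρ (u s) (b' i),
      empirical_eq_map, empirical_eq_map]
    refine (norm_velocity_sub_le hP1 hLH hLG (measurable_of_finite _).aemeasurable
      (measurable_of_finite _).aemeasurable (Eventually.of_forall b) (Eventually.of_forall b')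
      (η := 0) (δ := 0) (B := 0) hs (by simp) (by simp) le_rfl (by simp)).trans ?_
    have h1 (j) : ‖X s j - X' s j‖ ≤ ‖X s - X' s‖ := norm_le_pi_norm (X s - X' s) j
    have h2 : ∫ j, ‖X s j - X' s j‖ ∂(labelMeasure N) ≤ ‖X s - X' s‖ := by
      have h := norm_integral_le_of_norm_le_const (μ := labelMeasure N) (f := fun j => ‖X s j - X' s j‖)
        (C := ‖X s - X' s‖) (Eventually.of_forall fun z => by rw [norm_norm]; exact h1 z)
      exact (le_abs_self _).trans (h.trans (mul_le_of_le_one_right (norm_nonneg _) hP1))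
    calc _ ≤ L * (‖X s - X' s‖ + ‖X s - X' s‖) + d * (0 + U * (L * (‖X s - X' s‖ + 0))) := by
          gcongr <;> exact h1 i
      _ = _ := by rw [hK]; ring
  have hZc : ContinuousOn (fun s => ‖X s - X' s‖) (Icc 0 T) := (hXc.sub hXc').norm
  have hZ : ∀ t ∈ Icc 0 T, ‖X t - X' t‖ ≤ 0 + ∫ s in (0 : ℝ)..t, K * ‖X s - X' s‖ := by
    intro t ht
    rw [zero_add]
    have hnn : 0 ≤ ∫ s in (0 : ℝ)..t, K * ‖X s - X' s‖ :=
      intervalIntegral.integral_nonneg ht.1 fun s _ => by positivity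
    refine (pi_norm_le_iff_of_nonneg hnn).2 fun i => ?_
    have hd : HasCaratheodoryDeriv T (fun t => X t i - X' t i) (fun s =>
        velocity H G (empirical (X s)) (Y s) (u s) (X s i) -
        velocity H G (empirical (X' s)) (Y' s) (u s) (X' s i)) := by
      refine ⟨(h.followers i).absolutelyContinuous.sub (h'.followers i).absolutelyContinuous, ?_⟩
      filter_upwards [(h.followers i).ae_hasDerivAt, (h'.followers i).ae_hasDerivAt] with s h1 h2
      exact h1.sub h2
    have hB : ∀ᵐ s ∂(volume.restrict (Icc 0 T)),
        ‖velocity H G (empirical (X s)) (Y s) (u s) (X s i) -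
        velocity H G (empirical (X' s)) (Y' s) (u s) (X' s i)‖ ≤
          (⟨K * (A + A'), by positivity⟩ : ℝ≥0) := by
      filter_upwards [hvel, ae_restrict_mem measurableSet_Icc] with s hs hsT
      refine (hs i).trans ?_
      change _ ≤ K * (A + A')
      gcongr
      exact (norm_sub_le _ _).trans (add_le_add (hA s hsT) (hA' s hsT))
    -- Measurability of the integrand is inherited from its being an a.e. derivative.
    have e := hd.eq_integral hT hd.aestronglyMeasurable hB t ht
    rw [h.initial_followers, h'.initial_followers, sub_self, zero_add] at e
    rw [Pi.sub_apply, e]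
    refine intervalIntegral.norm_integral_le_of_norm_le ht.1 ?_ ?_
    · filter_upwards [(ae_restrict_iff' measurableSet_Icc).1 hvel] with s hs hsm
      exact hs ⟨hsm.1.le, hsm.2.trans ht.2⟩ i
    · refine ((hZc.mono ?_).intervalIntegrable).const_mul K
      exact (convex_Icc (0 : ℝ) T).ordConnected.uIcc_subset h0 ht
  intro t ht
  have := le_mul_exp_of_le_add_integral hK0 hZc hZ t ht
  rw [zero_mul] at this
  exact sub_eq_zero.1 (norm_le_zero_iff.1 this)

end FiniteSystem

/-! ### Wasserstein distance of image measures -/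

section Wasserstein

variable {d m : ℕ}

theorem chiDist_le (Y Y' : Fin m → AgentSpace d) (μ μ' : Measure (AgentSpace d)) :
    chiDist Y μ Y' μ' ≤ edist Y Y' + wassersteinOne μ μ' := by
  rw [chiDist]
  gcongr
  calc (m : ℝ≥0∞)⁻¹ * ∑ k, edist (Y k) (Y' k) ≤ (m : ℝ≥0∞)⁻¹ * (m * edist Y Y') := by
        gcongr
        exact (Finset.sum_le_card_nsmul _ _ _ fun k _ => edist_le_pi_edist Y Y' k).trans_eq
          (by simp)
    _ = ((m : ℝ≥0∞)⁻¹ * m) * edist Y Y' := (mul_assoc _ _ _).symm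
    _ ≤ edist Y Y' := mul_le_of_le_one_left zero_le (ENNReal.inv_mul_le_one _)

/-- The image of a coupling under `f × f'` couples the image measures. -/
theorem wassersteinOne_map_le {ν ν' : Measure (AgentSpace d)}
    {π : Measure (AgentSpace d × AgentSpace d)} (h : π.map Prod.fst = ν) (h' : π.map Prod.snd = ν')
    {f f' : AgentSpace d → AgentSpace d} (hf : Continuous f) (hf' : Continuous f') :
    wassersteinOne (ν.map f) (ν'.map f') ≤ ∫⁻ p, edist (f p.1) (f' p.2) ∂π := by
  have hm : Measurable (Prod.map f f') := (hf.prodMap hf').measurable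
  refine (iInf₂_le (π.map (Prod.map f f')) ⟨?_, ?_⟩).trans_eq ?_
  · rw [lintegral_map (by fun_prop) hm]
    rfl
  · rw [← h, Measure.map_map measurable_fst hm, Measure.map_map hf.measurable measurable_fst]
    rfl
  · rw [← h', Measure.map_map measurable_snd hm, Measure.map_map hf'.measurable measurable_snd]
    rfl

/-- The diagonal coupling of `ν` with itself moves mass by at most the sup distance of the maps. -/
theorem wassersteinOne_map_le_edist {ν : Measure (AgentSpace d)} (hν : ν univ ≤ 1)
    (f f' : AgentSpace d →ᵇ AgentSpace d) :
    wassersteinOne (ν.map f) (ν.map f') ≤ edist f f' := by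
  have hm : Measurable fun x : AgentSpace d => (x, x) := measurable_id.prodMk measurable_id
  refine (wassersteinOne_map_le (π := ν.map fun x => (x, x)) ?_ ?_ f.continuous
    f'.continuous).trans ?_
  · rw [Measure.map_map measurable_fst hm]; exact Measure.map_id
  · rw [Measure.map_map measurable_snd hm]; exact Measure.map_id
  · rw [lintegral_map (by fun_prop) hm]
    refine (lintegral_mono (g := fun _ => edist f f') fun x => ?_).trans ?_
    · rw [edist_dist, edist_dist]
      exact ENNReal.ofReal_le_ofReal (BoundedContinuousFunction.dist_coe_le_dist x)
    · rw [lintegral_const]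
      exact mul_le_of_le_one_right zero_le hν

end Wasserstein

/-! ### Weak solutions of the continuity equation from flows -/

section MeanField

variable {d m : ℕ} {L : ℝ≥0} {H H' : AgentSpace d → AgentSpace d}
  {G G' : Fin d → AgentSpace d → AgentSpace d} {hH' : LipschitzWith L H'}
  {hG' : ∀ ℓ, LipschitzWith L (G' ℓ)} {T : ℝ} {x₀ : AgentSpace d →ᵇ AgentSpace d}
  {u v : ℝ → Fin m → AgentSpace d} {Y₀ : Fin m → AgentSpace d}
  {Φ : ℝ → (AgentSpace d →ᵇ AgentSpace d)} {U : ℝ≥0} {η C r ρ : ℝ}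

theorem continuous_velocity (hH' : LipschitzWith L H') (hG' : ∀ ℓ, LipschitzWith L (G' ℓ))
    {μ : Measure (AgentSpace d)} [IsFiniteMeasure μ] (hμ : μ.real univ ≤ 1)
    (hρ : ∀ᵐ z ∂μ, ‖z‖ ≤ ρ) (Y v : Fin m → AgentSpace d) :
    Continuous (velocity H' G' μ Y v) := by
  refine LipschitzWith.continuous (K := L + d * (‖v‖₊ * L)) (LipschitzWith.of_dist_le_mul
    fun x x' => ?_)
  have h := norm_velocity_sub_le (x := x) (x' := x') (Y := Y) (v := v) (Y' := Y) (v' := v) hμ hH'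
    hG' aemeasurable_id aemeasurable_id hρ hρ
    (η := 0) (δ := 0) (B := 0) le_rfl (by simp) (by simp) le_rfl (by simp)
  rw [Measure.map_id] at h
  rw [dist_eq_norm, dist_eq_norm]
  refine h.trans_eq ?_
  simp only [sub_self, norm_zero, integral_zero, add_zero, zero_add]
  push_cast
  ring

/-- The flow of a probability measure transports it along a solution of the mean-field system. -/
theorem IsFlow.isMeanFieldSolution {ν : Measure (AgentSpace d)} [IsProbabilityMeasure ν]
    (hΦ : IsFlow hH' hG' T ν (leaders Y₀ v) v x₀ Φ) (hT : 0 ≤ T)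
    (hH : ∀ ξ, ‖ξ‖ ≤ r → H ξ = H' ξ) (hG : ∀ ℓ ξ, ‖ξ‖ ≤ r → G ℓ ξ = G' ℓ ξ)
    (h₁ : ρ + ρ ≤ r) (h₂ : ρ + η ≤ r)
    (hYη : ∀ s ∈ Icc 0 T, ‖leaders Y₀ v s‖ ≤ η)
    (hv : StronglyMeasurable v) (hvU : ∀ s, ‖v s‖ ≤ U) (hvu : v =ᵐ[volume.restrict (Icc 0 T)] u)
    (hC : 0 ≤ C) (hCH : ∀ ξ, ‖H' ξ‖ ≤ C * (1 + ‖ξ‖)) (hCG : ∀ ℓ ξ, ‖G' ℓ ξ‖ ≤ C * (1 + ‖ξ‖))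
    (hρ : ∀ s ∈ Icc 0 T, ‖Φ s‖ ≤ ρ) :
    IsMeanFieldSolution H G T u (leaders Y₀ v) (fun t => ν.map (Φ t)) := by
  have hν : ν.real univ ≤ 1 := by simp
  obtain ⟨B, hB⟩ := hΦ.exists_bound hν hYη hvU hC hCH hCG
  have hY := continuous_leaders Y₀ hv hvU
  have hFm := hΦ.aestronglyMeasurable hν hY hv (volume.restrict (Icc 0 T))
  have hm (t) : AEMeasurable (Φ t) ν := (Φ t).continuous.aemeasurable
  have hprob (t) : IsProbabilityMeasure (ν.map (Φ t)) := Measure.isProbabilityMeasure_map (hm t)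
  have hbΦ {t} (ht : t ∈ Icc 0 T) (x) : ‖Φ t x‖ ≤ ρ := ((Φ t).norm_coe_le_norm x).trans (hρ t ht)
  have hbμ {t} (ht : t ∈ Icc 0 T) : ∀ᵐ z ∂(ν.map (Φ t)), ‖z‖ ≤ ρ := by
    rw [ae_map_iff (hm t) (measurableSet_le measurable_norm measurable_const)]
    exact Eventually.of_forall (hbΦ ht)
  have hρ0 : 0 ≤ ρ := (norm_nonneg _).trans (hρ 0 ⟨le_rfl, hT⟩)
  refine ⟨fun t ht => ⟨hprob t, ?_⟩, ⟨ρ + 1, by positivity, fun t ht => ?_⟩, fun t ht => ?_,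
    fun k => ?_, fun φ hφ hφc => ?_⟩
  · refine Integrable.of_bound (C := ρ) continuous_norm.aestronglyMeasurable ?_
    filter_upwards [hbμ ht] with z hz
    rwa [norm_norm]
  · refine (Measure.support_subset_of_isClosed (t := Metric.closedBall 0 ρ)
      Metric.isClosed_closedBall ?_).trans (Metric.closedBall_subset_ball (by linarith))
    filter_upwards [hbμ ht] with z hz
    simpa using hz
  · have hlim : Tendsto (fun s => edist (leaders Y₀ v s) (leaders Y₀ v t) + edist (Φ s) (Φ t))
        (𝓝 t) (𝓝 0) := by
      have h : Continuous fun s => edist (leaders Y₀ v s) (leaders Y₀ v t) + edist (Φ s) (Φ t) :=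
        (hY.edist continuous_const).add (hΦ.continuous.edist continuous_const)
      simpa using h.tendsto t
    refine tendsto_of_tendsto_of_tendsto_of_le_of_le tendsto_const_nhds
      (hlim.mono_left nhdsWithin_le_nhds) (fun _ => zero_le) fun s => ?_
    refine (chiDist_le _ _ _ _).trans ?_
    gcongr
    exact wassersteinOne_map_le_edist (by simp) (Φ s) (Φ t)
  · refine (hasCaratheodoryDeriv_leaders Y₀ hT hv hvU k).congr_ae ?_
    filter_upwards [hvu] with s hs
    rw [hs]
  · obtain ⟨K, hK⟩ := hφ.lipschitzWith_of_hasCompactSupport hφc (by simp)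
    have hΦL : LipschitzOnWith B Φ (Icc 0 T) :=
      lipschitzOnWith_of_eq_integral hFm hB x₀ hΦ.eq_integral
    have hφm (t) : AEStronglyMeasurable (fun p => φ (Φ t p)) ν :=
      (hφ.continuous.comp (Φ t).continuous).aestronglyMeasurable
    obtain ⟨M, hM⟩ := hφc.exists_bound_of_continuous hφ.continuous
    have hφI (t) : Integrable (fun p => φ (Φ t p)) ν :=
      Integrable.of_bound (hφm t) M (Eventually.of_forall fun p => hM _)
    have heq : (fun t => ∫ x, φ x ∂(ν.map (Φ t))) = fun t => ∫ p, φ (Φ t p) ∂ν := by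
      funext t
      rw [integral_map (hm t) hφ.continuous.aestronglyMeasurable]
    have hptw (p) : LipschitzOnWith (K * B) (fun t => φ (Φ t p)) (Icc 0 T) := by
      have h1 : LipschitzOnWith (1 * B) (fun t => Φ t p) (Icc 0 T) :=
        (LipschitzWith.of_dist_le_mul fun f g => by
          simpa using BoundedContinuousFunction.dist_coe_le_dist (f := f) (g := g) p :
          LipschitzWith 1 fun f : AgentSpace d →ᵇ AgentSpace d => f p).comp_lipschitzOnWith hΦL
      rw [one_mul] at h1
      exact hK.comp_lipschitzOnWith h1
    rw [heq]
    refine ⟨LipschitzOnWith.absolutelyContinuousOnInterval (K := K * B) ?_, ?_⟩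
    · rw [uIcc_of_le hT]
      refine LipschitzOnWith.of_dist_le_mul fun s hs t ht => ?_
      rw [dist_eq_norm, ← integral_sub (hφI s) (hφI t)]
      refine (norm_integral_le_of_norm_le_const (C := ((K * B : ℝ≥0) : ℝ) * dist s t)
        (Eventually.of_forall fun p => ?_)).trans (by simp)
      rw [← dist_eq_norm]
      exact (hptw p).dist_le_mul s hs t ht
    · have hne₁ : ∀ᵐ t ∂(volume.restrict (Icc 0 T)), t ≠ 0 :=
        ae_restrict_of_ae (by simp [ae_iff])
      have hne₂ : ∀ᵐ t ∂(volume.restrict (Icc 0 T)), t ≠ T :=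
        ae_restrict_of_ae (by simp [ae_iff])
      -- Since `Φ` is differentiated in the sup norm, one null set of times serves every starting
      -- point `p`. At the remaining interior times the derivative passes under the integral,
      -- dominated by the common Lipschitz constant `K * B`.
      filter_upwards [(hasCaratheodoryDeriv_of_eq_integral hFm hB x₀ hT hΦ.eq_integral).ae_hasDerivAt,
        hvu, hne₁, hne₂, ae_restrict_mem measurableSet_Icc] with t hd hu h0 hT' ht
      have hnhds : Icc 0 T ∈ 𝓝 t :=
        Icc_mem_nhds (lt_of_le_of_ne ht.1 h0.symm) (lt_of_le_of_ne ht.2 hT')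
      have hvc : Continuous (velocity H' G' (ν.map (Φ t)) (leaders Y₀ v t) (v t)) :=
        continuous_velocity hH' hG' (by simp) (hbμ ht) _ _
      have hgc : Continuous (gradient φ) :=
        (InnerProductSpace.toDual ℝ (AgentSpace d)).symm.continuous.comp
          (hφ.continuous_fderiv (by simp))
      have hder := hasDerivAt_integral_of_dominated_loc_of_lip (μ := ν)
        (F := fun s p => φ (Φ s p)) (x₀ := t) (s := Icc 0 T)
        (F' := fun p => inner ℝ (gradient φ (Φ t p))
          (velocity H' G' (ν.map (Φ t)) (leaders Y₀ v t) (v t) (Φ t p)))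
        (bound := fun _ => ((K * B : ℝ≥0) : ℝ)) hnhds (Eventually.of_forall hφm) (hφI t)
        ((hgc.inner hvc).comp (Φ t).continuous).aestronglyMeasurable
        (Eventually.of_forall fun p => by
          rw [Real.nnabs_of_nonneg (NNReal.coe_nonneg _), Real.toNNReal_coe]
          exact hptw p)
        (integrable_const _)
        (Eventually.of_forall fun p => by
          have hg := (hφ.differentiable (by simp) (Φ t p)).hasGradientAt.hasFDerivAt
          have hp : HasDerivAt (fun s => Φ s p)
              (flowField hH' hG' ν (leaders Y₀ v t) (v t) (Φ t) p) t :=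
            (evalCLM ℝ p : (AgentSpace d →ᵇ AgentSpace d) →L[ℝ] _).hasFDerivAt.comp_hasDerivAt t hd
          rw [flowField_apply] at hp
          have hc := hg.comp_hasDerivAt t hp
          rw [InnerProductSpace.toDual_apply_apply] at hc
          exact hc)
      refine hder.2.congr_deriv ?_
      rw [← hu]
      -- The transported measure and the leaders stay in the region where truncated and original
      -- kernels agree.
      have hcongr : (fun x => inner ℝ (gradient φ x)
          (velocity H G (ν.map (Φ t)) (leaders Y₀ v t) (v t) x)) =ᵐ[ν.map (Φ t)]
          fun x => inner ℝ (gradient φ x)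
            (velocity H' G' (ν.map (Φ t)) (leaders Y₀ v t) (v t) x) := by
        filter_upwards [hbμ ht] with x hx
        rw [velocity_congr hH hG h₁ h₂ (hbμ ht) (hYη t ht) (v t) hx]
      rw [integral_congr_ae hcongr, integral_map (hm t) (hgc.inner hvc).aestronglyMeasurable]

end MeanField

/-! ### Stability in the Wasserstein distance -/

section Limit

variable {d m : ℕ}

/-- The clamping map as a bounded continuous function. -/
def clampFlow (d : ℕ) {r : ℝ} (hr : 0 ≤ r) : AgentSpace d →ᵇ AgentSpace d :=
  BoundedContinuousFunction.ofNormedAddCommGroup (clampBox r) (clampBox_lipschitz r).continuous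
    √(d * r ^ 2) (norm_clampBox_le_const hr)

theorem norm_clampFlow_le {r : ℝ} (hr : 0 ≤ r) : ‖clampFlow d hr‖ ≤ √(d * r ^ 2) :=
  BoundedContinuousFunction.norm_ofNormedAddCommGroup_le _ (Real.sqrt_nonneg _) _

/-- The stability constant does not depend on the coupling, so the estimate survives the infimum
over all couplings of `ν` and `ν'`. -/
theorem IsFlow.wassersteinOne_le {L : ℝ≥0} {H : AgentSpace d → AgentSpace d}
    {G : Fin d → AgentSpace d → AgentSpace d} {hH : LipschitzWith L H}
    {hG : ∀ ℓ, LipschitzWith L (G ℓ)} {ν ν' : Measure (AgentSpace d)} {T : ℝ}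
    {Y v Y' v' : ℝ → Fin m → AgentSpace d} {R : ℝ} {hR : 0 ≤ R}
    {Φ Φ' : ℝ → (AgentSpace d →ᵇ AgentSpace d)} {U : ℝ≥0} {η C A : ℝ} {e : ℝ≥0∞}
    [IsFiniteMeasure ν] [IsFiniteMeasure ν']
    (hν : ν.real univ ≤ 1) (hν' : ν'.real univ ≤ 1)
    (hΦ : IsFlow hH hG T ν Y v (clampFlow d hR) Φ)
    (hΦ' : IsFlow hH hG T ν' Y' v' (clampFlow d hR) Φ')
    (hY : Continuous Y) (hY' : Continuous Y')
    (hYη : ∀ s ∈ Icc 0 T, ‖Y s‖ ≤ η) (hYη' : ∀ s ∈ Icc 0 T, ‖Y' s‖ ≤ η)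
    (hv : StronglyMeasurable v) (hv' : StronglyMeasurable v')
    (hvU : ∀ s, ‖v s‖ ≤ U) (hvU' : ∀ s, ‖v' s‖ ≤ U) (hC : 0 ≤ C)
    (hCH : ∀ ξ, ‖H ξ‖ ≤ C * (1 + ‖ξ‖)) (hCG : ∀ ℓ ξ, ‖G ℓ ξ‖ ≤ C * (1 + ‖ξ‖))
    (hA : ∀ s ∈ Icc 0 T, ‖Φ s‖ ≤ A) (hA' : ∀ s ∈ Icc 0 T, ‖Φ' s‖ ≤ A) (he : e ≠ ⊤)
    (hYY : ∀ s ∈ Icc 0 T, ‖Y s - Y' s‖ ≤ T * e.toReal)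
    (hvv : ∀ᵐ s ∂(volume.restrict (Icc 0 T)), ‖v s - v' s‖ ≤ e.toReal) {t : ℝ}
    (ht : t ∈ Icc 0 T) :
    wassersteinOne (ν.map (Φ t)) (ν'.map (Φ' t)) ≤
      ENNReal.ofReal (stabilityConst d L U C A η T) * (wassersteinOne ν ν' + e) := by
  have hA0 := (norm_nonneg _).trans (hA t ht)
  have hη0 := (norm_nonneg _).trans (hYη t ht)
  have hT0 := ht.1.trans ht.2
  -- A factor of an infimum in `ℝ≥0∞` can be pulled inside when it is neither `0` nor `⊤`.
  have hK : 0 < stabilityConst d L U C A η T := by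
    unfold stabilityConst
    positivity
  set K := stabilityConst d L U C A η T with hKdef
  rw [wassersteinOne.eq_def ν ν', ENNReal.iInf_add,
    ENNReal.mul_iInf_of_ne (by simpa using hK) ENNReal.ofReal_ne_top]
  refine le_iInf fun π => ?_
  rw [ENNReal.iInf_add, ENNReal.mul_iInf_of_ne (by simpa using hK) ENNReal.ofReal_ne_top]
  refine le_iInf fun hπ => (wassersteinOne_map_le hπ.1 hπ.2 (Φ t).continuous
    (Φ' t).continuous).trans ?_
  have : IsFiniteMeasure π := ⟨by
    have : π univ = ν univ := by
      rw [← hπ.1, Measure.map_apply measurable_fst MeasurableSet.univ, preimage_univ]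
    rw [this]
    exact measure_lt_top ν _⟩
  have hconv (f f' : AgentSpace d →ᵇ AgentSpace d) :
      ∫⁻ p, edist (f p.1) (f' p.2) ∂π = ENNReal.ofReal (∫ p, ‖f p.1 - f' p.2‖ ∂π) := by
    rw [ofReal_integral_eq_lintegral_ofReal]
    · simp only [edist_dist, dist_eq_norm]
    · refine Integrable.of_bound (((f.continuous.comp continuous_fst).sub
        (f'.continuous.comp continuous_snd)).norm).aestronglyMeasurable (‖f‖ + ‖f'‖)
        (Eventually.of_forall fun p => ?_)
      rw [norm_norm]
      exact (norm_sub_le _ _).trans (add_le_add (f.norm_coe_le_norm _) (f'.norm_coe_le_norm _))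
    · exact Eventually.of_forall fun p => norm_nonneg _
  have key := IsFlow.integral_norm_sub_le hν hν' hΦ hΦ' hY hY' hYη hYη' hv hv' hvU hvU' hC hCH hCG
    hA hA' ENNReal.toReal_nonneg hYY hvv hπ.1 hπ.2 ht
  rw [hconv]
  refine (ENNReal.ofReal_le_ofReal key).trans ?_
  rw [ENNReal.ofReal_mul hK.le, ENNReal.ofReal_add (integral_nonneg fun _ => norm_nonneg _)
    ENNReal.toReal_nonneg, ENNReal.ofReal_toReal he, ← hconv]
  gcongr with p
  -- The starting map is nonexpansive, so its cost under `π` is at most the transport cost of `π`.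
  have := (clampBox_lipschitz (d := d) R).edist_le_mul p.1 p.2
  change edist (clampBox R p.1) (clampBox R p.2) ≤ _
  simpa using this

theorem ae_norm_sub_le_toReal {F : Type*} [NormedAddCommGroup F] {κ : Measure ℝ}
    {u u' v v' : ℝ → F} (hv : v =ᵐ[κ] u) (hv' : v' =ᵐ[κ] u')
    (h : eLpNorm (fun t => u t - u' t) ⊤ κ ≠ ⊤) :
    ∀ᵐ s ∂κ, ‖v s - v' s‖ ≤ (eLpNorm (fun t => u t - u' t) ⊤ κ).toReal := by
  have h1 := enorm_ae_le_eLpNormEssSup (fun t => u t - u' t) κ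
  rw [← eLpNorm_exponent_top] at h1
  filter_upwards [h1, hv, hv'] with s hs e e'
  rw [e, e', ← toReal_enorm]
  exact ENNReal.toReal_mono h hs

end Limit

end
-- Assembly of the mean-field limit
/-- Mean-field limit: the finite systems are well posed, and their solutions converge in
`C⁰([0,T], χ)` to a weak solution of the coupled ODE / continuity equation. -/
theorem mainTheorem1 {d m : ℕ} (H : AgentSpace d → AgentSpace d)
    (G : Fin d → AgentSpace d → AgentSpace d) (hHG : KernelHypothesis H G)
    (T : ℝ) (hT : 0 < T)
    (𝒰 : Set (Fin m → AgentSpace d)) (h𝒰 : IsCompact 𝒰) (h𝒰ne : 𝒰.Nonempty)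
    (R : ℝ) (Y0 : Fin m → AgentSpace d)
    (μ0 : Measure (AgentSpace d)) (hμ0 : MemP1 μ0) (hμ0R : μ0.support ⊆ Metric.closedBall 0 R)
    (X0 : (N : ℕ) → Fin N → AgentSpace d) (hX0 : ∀ N i, X0 N i ∈ Metric.closedBall 0 R)
    (hX0μ : Tendsto (fun N => wassersteinOne (empirical (X0 N)) μ0) atTop (𝓝 0))
    (u : ℕ → ℝ → Fin m → AgentSpace d) (hu : ∀ N, IsControl T 𝒰 (u N))
    (uStar : ℝ → Fin m → AgentSpace d) (huStar : IsControl T 𝒰 uStar)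
    (huu : Tendsto (fun N => eLpNorm (fun t => u N t - uStar t) ∞
      (volume.restrict (Set.Icc 0 T))) atTop (𝓝 0)) :
    (∀ N, ∃ Y X, IsFiniteSolution H G T (u N) Y0 (X0 N) Y X) ∧
    (∀ N Y X Y' X', IsFiniteSolution H G T (u N) Y0 (X0 N) Y X →
      IsFiniteSolution H G T (u N) Y0 (X0 N) Y' X' →
      Set.EqOn Y Y' (Set.Icc 0 T) ∧ Set.EqOn X X' (Set.Icc 0 T)) ∧
    ∀ (Y : ℕ → ℝ → Fin m → AgentSpace d) (X : (N : ℕ) → ℝ → Fin N → AgentSpace d),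
      (∀ N, IsFiniteSolution H G T (u N) Y0 (X0 N) (Y N) (X N)) →
      ∃ (YStar : ℝ → Fin m → AgentSpace d) (μStar : ℝ → Measure (AgentSpace d)),
        IsMeanFieldSolution H G T uStar YStar μStar ∧ YStar 0 = Y0 ∧ μStar 0 = μ0 ∧
        Tendsto (fun N => ⨆ t ∈ Set.Icc 0 T,
          chiDist (Y N t) (empirical (X N t)) (YStar t) (μStar t)) atTop (𝓝 0) := by
  have hprob := hμ0.isProbability
  obtain ⟨U₀, hU₀⟩ := h𝒰.isBounded.exists_norm_le
  obtain ⟨U, hU⟩ : ∃ U : NNReal, ∀ w ∈ 𝒰, ‖w‖ ≤ U :=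
    ⟨U₀.toNNReal, fun w hw => (hU₀ w hw).trans (Real.le_coe_toNNReal _)⟩
  obtain ⟨C, hC, hCH₀, hCG₀⟩ := hHG.exists_growth
  choose v hvm hvmem hvu using fun N => (hu N).exists_version h𝒰 h𝒰ne
  obtain ⟨w, hwm, hwmem, hwu⟩ := huStar.exists_version h𝒰 h𝒰ne
  have hvU N s := hU _ (hvmem N s)
  have hwU s := hU _ (hwmem s)
  -- This bounded substitute for the identity fixes all initial particles and the support of `μ0`.
  -- The sign of `R` is not prescribed, hence `|R|`.
  set x₀ := clampFlow d (abs_nonneg R)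
  have hx₀ {x : AgentSpace d} (hx : x ∈ Metric.closedBall 0 R) : x₀ x = x :=
    clampBox_of_norm_le ((mem_closedBall_zero_iff.1 hx).trans (le_abs_self R))
  set η := ‖Y0‖ + T * U
  have hη : 0 ≤ η := by positivity
  -- The bound uses the growth constant of the untruncated kernels; `√(d * |R| ^ 2)` bounds the
  -- starting map. It is thus available before `r` and `L` are chosen.
  set A := flowBound d C U η T √(d * |R| ^ 2) with hAdef
  have hA : 0 ≤ A := by
    rw [hAdef, flowBound]
    positivity
  -- Kernel arguments are differences of two followers, at most `A + A`, or of a follower and a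
  -- leader, at most `A + η`.
  set r := A + A + η
  have hr : 0 ≤ r := by positivity
  obtain ⟨L, hLH, hLG⟩ := hHG.exists_truncation hr
  have hHe : ∀ ξ, ‖ξ‖ ≤ r → H ξ = H (clampBox r ξ) := fun ξ hξ => by rw [clampBox_of_norm_le hξ]
  have hGe : ∀ ℓ ξ, ‖ξ‖ ≤ r → G ℓ ξ = G ℓ (clampBox r ξ) := fun ℓ ξ hξ => by
    rw [clampBox_of_norm_le hξ]
  have hCH : ∀ ξ, ‖H (clampBox r ξ)‖ ≤ C * (1 + ‖ξ‖) := fun ξ =>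
    (hCH₀ _).trans (by gcongr; exact norm_clampBox_le hr ξ)
  have hCG : ∀ ℓ ξ, ‖G ℓ (clampBox r ξ)‖ ≤ C * (1 + ‖ξ‖) := fun ℓ ξ =>
    (hCG₀ ℓ _).trans (by gcongr; exact norm_clampBox_le hr ξ)
  have hYη {v : ℝ → Fin m → AgentSpace d} (hvU : ∀ s, ‖v s‖ ≤ U) :
      ∀ s ∈ Set.Icc 0 T, ‖leaders Y0 v s‖ ≤ η := fun s hs => norm_leaders_le Y0 hvU hs
  have hex {v : ℝ → Fin m → AgentSpace d} (hv : StronglyMeasurable v) (hvU : ∀ s, ‖v s‖ ≤ U)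
      (ν : Measure (AgentSpace d)) [IsFiniteMeasure ν] (hν : ν.real Set.univ ≤ 1) :
      ∃ Φ, IsFlow hLH hLG T ν (leaders Y0 v) v x₀ Φ ∧ ∀ s ∈ Set.Icc 0 T, ‖Φ s‖ ≤ A := by
    obtain ⟨Φ, hΦ⟩ := exists_isFlow hLH hLG hν hT.le (continuous_leaders Y0 hv hvU) (hYη hvU) hv
      hvU hC hCH hCG x₀
    exact ⟨Φ, hΦ, hΦ.norm_le hν (hYη hvU) hvU hC hCH hCG (norm_clampFlow_le _)⟩
  have hfin N := isFiniteMeasure_empirical (X0 N)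
  choose Φ hΦ hΦA using fun N => @hex (v N) (hvm N) (hvU N) _ (hfin N).1 (hfin N).2
  have hsol N : IsFiniteSolution H G T (u N) Y0 (X0 N) (leaders Y0 (v N))
      (fun t i => Φ N t (X0 N i)) :=
    (hΦ N).isFiniteSolution hT.le hHe hGe (le_add_of_nonneg_right hη) (by simp only [r]; linarith)
      (hYη (hvU N)) (hvm N) (hvU N) (hvu N) hC hCH hCG (hΦA N) fun i => hx₀ (hX0 N i)
  have huniq N (Y X Y' X') (h : IsFiniteSolution H G T (u N) Y0 (X0 N) Y X)
      (h' : IsFiniteSolution H G T (u N) Y0 (X0 N) Y' X') :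
      Set.EqOn Y Y' (Set.Icc 0 T) ∧ Set.EqOn X X' (Set.Icc 0 T) :=
    h.eqOn hHG hT.le ((hu N).mem.mono fun t ht => hU _ ht) h'
  refine ⟨fun N => ⟨_, _, hsol N⟩, huniq, fun Y X hYX => ?_⟩
  have hμ1 : μ0.real Set.univ ≤ 1 := by simp
  obtain ⟨Ψ, hΨ, hΨA⟩ := hex hwm hwU μ0 hμ1
  refine ⟨leaders Y0 w, fun t => μ0.map (Ψ t), hΨ.isMeanFieldSolution hT.le hHe hGe
    (le_add_of_nonneg_right hη) (by simp only [r]; linarith) (hYη hwU) hwm hwU hwu hC hCH hCG hΨA,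
    by simp [leaders], ?_, ?_⟩
  -- `μ0` is concentrated on its support, where the starting map is the identity.
  · have h0 : ∀ᵐ x ∂μ0, Ψ 0 x = id x := by
      filter_upwards [Measure.support_mem_ae (μ := μ0)] with x hx
      rw [hΨ.eq_integral 0 ⟨le_rfl, hT.le⟩, intervalIntegral.integral_same, add_zero, id,
        hx₀ (hμ0R hx)]
    exact (Measure.map_congr h0).trans Measure.map_id
  set e : ℕ → ENNReal := fun N => eLpNorm (fun t => u N t - uStar t) ∞
    (volume.restrict (Set.Icc 0 T)) with he
  set K := ENNReal.ofReal (stabilityConst d L U C A η T)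
  have hlim : Tendsto (fun N => ENNReal.ofReal T * e N +
      K * (wassersteinOne (empirical (X0 N)) μ0 + e N)) atTop (𝓝 0) := by
    have h := (ENNReal.Tendsto.const_mul (a := ENNReal.ofReal T) huu
      (Or.inr ENNReal.ofReal_ne_top)).add
      (ENNReal.Tendsto.const_mul (a := K) (hX0μ.add huu) (Or.inr ENNReal.ofReal_ne_top))
    simpa using h
  refine tendsto_of_tendsto_of_tendsto_of_le_of_le' tendsto_const_nhds hlim
    (Eventually.of_forall fun _ => zero_le) ?_
  -- Passing to real-valued estimates requires a finite distance of the controls, which convergence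
  -- supplies for large `N`.
  filter_upwards [huu.eventually_lt_const ENNReal.zero_lt_top] with N hN
  refine iSup₂_le fun t ht => ?_
  have hvv := ae_norm_sub_le_toReal (hvu N) hwu hN.ne
  have hYY : ∀ s ∈ Set.Icc 0 T, ‖leaders Y0 (v N) s - leaders Y0 w s‖ ≤ T * (e N).toReal :=
    fun s hs => norm_leaders_sub_le Y0 (hvm N) (hvU N) hwm hwU ENNReal.toReal_nonneg hvv hs
  -- By uniqueness the given solution is the one read off from the flow `Φ N`.
  obtain ⟨hY, hX⟩ := huniq N _ _ _ _ (hYX N) (hsol N)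
  have := (hfin N).1
  rw [hY ht, hX ht, ← map_empirical (Φ N t).continuous.measurable]
  refine (chiDist_le _ _ _ _).trans (add_le_add ?_ ?_)
  · rw [edist_dist, dist_eq_norm]
    refine (ENNReal.ofReal_le_ofReal (hYY t ht)).trans_eq ?_
    rw [ENNReal.ofReal_mul hT.le, ENNReal.ofReal_toReal hN.ne]
  · exact IsFlow.wassersteinOne_le (hfin N).2 hμ1 (hΦ N) hΨ
      (continuous_leaders Y0 (hvm N) (hvU N)) (continuous_leaders Y0 hwm hwU) (hYη (hvU N))
      (hYη hwU) (hvm N) hwm (hvU N) hwU hC hCH hCG (hΦA N) hΨA hN.ne hYY hvv ht
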